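/- Let $n\ge 2$ and $N\ge 1$ be integers, let $\alpha^1,\dots,\alpha^n,\beta$ be self-adjoint complex $N\times N$ matrices with $\alpha^j\alpha^k+\alpha^k\alpha^j=2\delta_{jk}I_N$, $\alpha^j\beta+\beta\alpha^j=0$, $\beta^2=I_N$, and let $D_0=-\mathrm i\sum_j\alpha^j\partial_{x_j}$ and $\bar\psi=\psi^*\beta$. Let $m\in\mathbb R$, $M\ge 0$, $\mathrm g>0$, and consider the Dirac--Klein--Gordon system $$\mathrm i\partial_t\psi=D_0\psi+(m-\mathrm g\varphi)\beta\psi,\qquad (\partial_t^2-\Delta+M^2)\varphi=\bar\psi\psi,$$ with $\psi(t,x)\in\mathbb C^N$, $\varphi(t,x)\in\mathbb R$, $x\in\mathbb R^n$. A solitary wave of frequency $\omega\in\mathbb R$ is a classical solution ($\psi$ of class $C^1$, $\varphi$ of class $C^2$) of the form $(\psi,\varphi)=(\phi(x)e^{-\mathrm i\omega t},h(x))$ such that $\phi\not\equiv 0$, $\phi\in L^2(\mathbb R^n,\mathbb C^N)$, $h\in L^\infty(\mathbb R^n,\mathbb R)$, $\nabla h\in L^2$ and $Mh\in L^2$. Put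 $$K(\phi)=\int_{\mathbb R^n}\phi^*D_0\phi\,dx,\qquad E(\phi,h)=\int_{\mathbb R^n}\Big(\phi^*D_0\phi+m\,\bar\phi\phi-\mathrm g h\,\bar\phi\phi+\frac{\mathrm g}{2}|\nabla h|^2+\frac{\mathrm g M^2}{2}h^2\Big)dx.$$ Then for every solitary wave with $\omega\ge 0$ both integrals converge absolutely, both are real, and $$K(\phi)>0,\qquad E(\phi,h)>0.$$ -/

import Mathlib

open MeasureTheory
open scoped Matrix ComplexOrder

namespace DKG

/-- The space `ℝⁿ` with its Euclidean structure. -/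
abbrev Space (n : ℕ) : Type := EuclideanSpace ℝ (Fin n)

/-- Dirac matrices `α¹, …, αⁿ, β` of size `N × N` in spatial dimension `n`: self-adjoint matrices with
the anticommutation relations of the Dirac operator. -/
structure DiracMatrices (n N : ℕ) where
  α : Fin n → Matrix (Fin N) (Fin N) ℂ
  β : Matrix (Fin N) (Fin N) ℂ
  α_selfAdjoint : ∀ j, (α j).IsHermitian
  β_selfAdjoint : β.IsHermitian
  α_anticomm : ∀ j k, α j * α k + α k * α j = if j = k then 2 else 0
  α_β_anticomm : ∀ j, α j * β + β * α j = 0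
  β_sq : β * β = 1

/-- The parameters of the system: the fermion mass `m`, the boson mass `M ≥ 0`, and the coupling
constant `g > 0`. -/
structure Params where
  m : ℝ
  M : ℝ
  g : ℝ
  M_nonneg : 0 ≤ M
  g_pos : 0 < g

noncomputable section

variable {n N : ℕ}

/-- The massless Dirac operator `D₀ = -i α · ∇`. -/
def diracOp (A : DiracMatrices n N) (φ : Space n → Fin N → ℂ) (x : Space n) : Fin N → ℂ :=
  -Complex.I • ∑ j, A.α j *ᵥ fderiv ℝ φ x (EuclideanSpace.single j 1)

/-- The scalar `φ̄φ = φ* β φ` of a spinor. -/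
def barProd (A : DiracMatrices n N) (v : Fin N → ℂ) : ℂ := star v ⬝ᵥ (A.β *ᵥ v)

/-- `(ψ, χ)` is a classical solution of the Dirac–Klein–Gordon system
`i ∂ₜψ = D₀ψ + (m - gχ)βψ`, `(∂ₜ² - Δ + M²)χ = ψ̄ψ`. -/
structure IsSolution (A : DiracMatrices n N) (p : Params)
    (ψ : ℝ → Space n → Fin N → ℂ) (χ : ℝ → Space n → ℝ) : Prop where
  contDiff_spinor : ContDiff ℝ 1 (fun z : ℝ × Space n => ψ z.1 z.2)
  contDiff_scalar : ContDiff ℝ 2 (fun z : ℝ × Space n => χ z.1 z.2)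
  dirac : ∀ t x, Complex.I • deriv (fun s => ψ s x) t
    = diracOp A (ψ t) x + ((p.m - p.g * χ t x : ℝ) : ℂ) • (A.β *ᵥ ψ t x)
  kleinGordon : ∀ t x,
    ((iteratedDeriv 2 (fun s => χ s x) t - Laplacian.laplacian (χ t) x + p.M ^ 2 * χ t x : ℝ) : ℂ)
      = barProd A (ψ t x)

/-- `(φ(x) e^{-iωt}, h(x))` is a solitary wave: a nonzero localized solution of the system, with
`φ ∈ L²`, `h ∈ L^∞`, and with finite energy of the boson field. -/
structure IsSolitaryWave (A : DiracMatrices n N) (p : Params) (ω : ℝ)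
    (φ : Space n → Fin N → ℂ) (h : Space n → ℝ) : Prop where
  isSolution : IsSolution A p
    (fun t x => Complex.exp (-Complex.I * (ω : ℂ) * (t : ℂ)) • φ x) (fun _ x => h x)
  ne_zero : φ ≠ 0
  memLp_spinor : MemLp φ 2 volume
  bounded_scalar : ∃ C : ℝ, ∀ x, |h x| ≤ C
  memLp_gradient : MemLp (gradient h) 2 volume
  memLp_mass : MemLp (fun x => p.M * h x) 2 volume

/-- The kinetic density `φ* D₀ φ`. -/
def kineticDensity (A : DiracMatrices n N) (φ : Space n → Fin N → ℂ) (x : Space n) : ℂ :=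
  star (φ x) ⬝ᵥ diracOp A φ x

/-- The energy density
`φ* D₀ φ + m φ̄φ - g h φ̄φ + (g/2)|∇h|² + (g M²/2) h²`. -/
def energyDensity (A : DiracMatrices n N) (p : Params)
    (φ : Space n → Fin N → ℂ) (h : Space n → ℝ) (x : Space n) : ℂ :=
  kineticDensity A φ x + (p.m : ℂ) * barProd A (φ x) - (p.g : ℂ) * (h x : ℂ) * barProd A (φ x)
    + ((p.g / 2 * ‖gradient h x‖ ^ 2 + p.g * p.M ^ 2 / 2 * h x ^ 2 : ℝ) : ℂ)

/-- The kinetic term `K(φ) = ∫ φ* D₀ φ`. -/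
def kinetic (A : DiracMatrices n N) (φ : Space n → Fin N → ℂ) : ℂ :=
  ∫ x, kineticDensity A φ x

/-- The energy `E(φ, h)`. -/
def energy (A : DiracMatrices n N) (p : Params)
    (φ : Space n → Fin N → ℂ) (h : Space n → ℝ) : ℂ :=
  ∫ x, energyDensity A p φ h x

end

end DKG

/-! Write Q = ∫|φ|², T = ∫|∇h|², G = ∫M²h², w = m - g h. At time zero the system becomes D₀φ = ωφ -
wβφ and -Δh + M²h = φ̄φ. The Dirac equation turns the energy density into ω|φ|² + (g/2)|∇h|² +
(g/2)M²h², so E = ωQ + (g/2)(T + G), and K = ωQ - ∫ w φ̄φ.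

The sign of K comes from the Pohozaev identity K = (n-2)(g/2)T + n(g/2)G. The stress tensor of the
stationary system is divergence free; testing it against truncated dilations shows that each
diagonal entry has zero integral (`IsStationary.integral_stress_diag`), and their sum is the
identity. Integrability of the stress needs ∇φ ∈ L². Since h is bounded, D₀φ ∈ L², and the Clifford
relations give ∇φ ∈ L² (`integrable_pd_of_diracOp`). As φ is only C¹, second derivatives of φ are
avoided throughout by exchanging derivatives under the integral (`integral_bilin_pd_swap`).

The case T = G = 0 is impossible (`IsStationary.not_trivial_scalar`): h would be constant with φ̄φ =
0, hence ω = 0, then the constant w vanishes, and D₀φ = 0 forces φ = 0 in L². So E > 0, and Pohozaev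
gives K > 0 except when n = 2 and G = 0. There M = 0, and pairing the scalar equation with w gives ∫
w φ̄φ = -gT, so K = ωQ + gT > 0. Only this case uses ω ≥ 0 for K; as Pohozaev gives K = 0 there, it
does not in fact occur. -/

namespace DKG

open Filter Topology
open scoped Convolution

/-! ### Partial derivatives and integration by parts for C¹ functions. -/

section Calculus

variable {n : ℕ} {E F : Type*} [NormedAddCommGroup E] [NormedSpace ℝ E]
  [NormedAddCommGroup F] [NormedSpace ℝ F]

/-- The partial derivative `∂ⱼ f`. -/
noncomputable def pd (j : Fin n) (f : Space n → E) (x : Space n) : E :=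
  fderiv ℝ f x (EuclideanSpace.single j 1)

theorem continuous_pd {f : Space n → E} (hf : ContDiff ℝ 1 f) (j : Fin n) :
    Continuous (pd j f) :=
  (hf.continuous_fderiv one_ne_zero).clm_apply continuous_const

theorem contDiff_pd {f : Space n → E} (hf : ContDiff ℝ 2 f) (j : Fin n) :
    ContDiff ℝ 1 (pd j f) :=
  (hf.fderiv_right (m := 1) (by norm_num)).clm_apply contDiff_const

theorem hasCompactSupport_pd {f : Space n → E} (hf : HasCompactSupport f) (j : Fin n) :
    HasCompactSupport (pd j f) :=
  hf.fderiv_apply (𝕜 := ℝ) _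

theorem pd_zero_of_notMem_tsupport {f : Space n → E} {x : Space n} (hx : x ∉ tsupport f)
    (j : Fin n) : pd j f x = 0 := by
  simp [pd, fderiv_of_notMem_tsupport (𝕜 := ℝ) hx]

theorem pd_smul {f : Space n → ℝ} {u : Space n → E} {x : Space n}
    (hf : DifferentiableAt ℝ f x) (hu : DifferentiableAt ℝ u x) (j : Fin n) :
    pd j (fun y => f y • u y) x = pd j f x • u x + f x • pd j u x := by
  simp only [pd]
  rw [fderiv_fun_smul hf hu]
  simp [add_comm]

theorem pd_mul {f u : Space n → ℝ} {x : Space n}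
    (hf : DifferentiableAt ℝ f x) (hu : DifferentiableAt ℝ u x) (j : Fin n) :
    pd j (fun y => f y * u y) x = pd j f x * u x + f x * pd j u x :=
  pd_smul hf hu j

theorem pd_bilin (B : E →L[ℝ] F →L[ℝ] ℝ) {u : Space n → E} {v : Space n → F} {x : Space n}
    (hu : DifferentiableAt ℝ u x) (hv : DifferentiableAt ℝ v x) (j : Fin n) :
    pd j (fun y => B (u y) (v y)) x = B (pd j u x) (v x) + B (u x) (pd j v x) := by
  simp only [pd]
  rw [B.fderiv_of_bilinear hu hv]
  simp [add_comm]

theorem integral_pd_eq_zero {f : Space n → ℝ} (hf : Differentiable ℝ f) (hi : Integrable f)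
    (j : Fin n) (hi' : Integrable (pd j f)) : ∫ x, pd j f x = 0 := by
  have := integral_mul_fderiv_eq_neg_fderiv_mul_of_integrable (𝕜 := ℝ) (μ := (volume : Measure (Space n)))
    (f := fun _ => (1 : ℝ)) (g := f) (v := EuclideanSpace.single j 1)
    (by simp) (by simpa using! hi') (by simpa using hi) (fun x _ => by fun_prop)
    (fun x _ => hf x)
  simpa [pd] using this

theorem integral_pd_eq_zero_of_hasCompactSupport {f : Space n → ℝ} (hf : ContDiff ℝ 1 f)
    (hc : HasCompactSupport f) (j : Fin n) : ∫ x, pd j f x = 0 :=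
  integral_pd_eq_zero (hf.differentiable one_ne_zero) (hf.continuous.integrable_of_hasCompactSupport hc)
    j ((continuous_pd hf j).integrable_of_hasCompactSupport (hasCompactSupport_pd hc j))

theorem pd_convolution_right (B : E →L[ℝ] F →L[ℝ] ℝ) {u : Space n → E} {v : Space n → F}
    (hu : Continuous u) (hv : ContDiff ℝ 1 v) (hcv : HasCompactSupport v) (k : Fin n) :
    pd k (u ⋆[B, volume] v) = u ⋆[B, volume] pd k v := by
  ext x
  have := hcv.hasFDerivAt_convolution_right B (μ := volume) hu.locallyIntegrable hv x
  simp only [pd]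
  rw [this.fderiv, convolution_precompR_apply B hu.locallyIntegrable (hcv.fderiv ℝ)
    (hv.continuous_fderiv one_ne_zero)]
  rfl

theorem pd_convolution_left (B : E →L[ℝ] F →L[ℝ] ℝ) {u : Space n → E} {v : Space n → F}
    (hu : ContDiff ℝ 1 u) (hcu : HasCompactSupport u) (hv : Continuous v) (k : Fin n) :
    pd k (u ⋆[B, volume] v) = pd k u ⋆[B, volume] v := by
  rw [← convolution_flip, pd_convolution_right B.flip hv hu hcu, convolution_flip]

/-- Two integrations by parts would need second derivatives of one factor. A convolution of C¹
functions can instead take one derivative on each factor, and the integral is such a convolution,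
with the second factor reflected, evaluated at 0. -/
theorem integral_bilin_pd_swap_aux (B : E →L[ℝ] F →L[ℝ] ℝ) {u : Space n → E} {v : Space n → F}
    (hu : ContDiff ℝ 1 u) (hcu : HasCompactSupport u) (hv : ContDiff ℝ 1 v)
    (hcv : HasCompactSupport v) (j k : Fin n) :
    ∫ x, B (pd j u x) (pd k v x) = ∫ x, B (pd k u x) (pd j v x) := by
  set g : Space n → F := fun y => v (-y) with hg
  have hg1 : ContDiff ℝ 1 g := hv.comp contDiff_neg
  have hcg : HasCompactSupport g := hcv.comp_homeomorph (Homeomorph.neg _)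
  have hpd : ∀ (i : Fin n) (t : Space n), pd i g (0 - t) = -pd i v t := by
    intro i t
    simp only [pd, hg]
    have hd : HasFDerivAt v (fderiv ℝ v (-(0 - t))) (-(0 - t)) :=
      (hv.differentiable one_ne_zero _).hasFDerivAt
    have hc : HasFDerivAt (fun y => v (-y)) _ (0 - t) :=
      hd.comp (0 - t) (hasFDerivAt_id (𝕜 := ℝ) (0 - t)).neg
    rw [hc.fderiv]
    simp
  -- Both sides equal ∂ₖ∂ⱼ(u ⋆ g); each derivative is moved to either factor in turn.
  have key : pd j u ⋆[B, volume] pd k g = pd k u ⋆[B, volume] pd j g := by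
    rw [← pd_convolution_right B (continuous_pd hu j) hg1 hcg,
      ← pd_convolution_left B hu hcu hg1.continuous,
      pd_convolution_right B hu.continuous hg1 hcg,
      pd_convolution_left B hu hcu (continuous_pd hg1 j)]
  have h0 := congrFun key 0
  simp only [convolution, hpd, map_neg, integral_neg, neg_inj] at h0
  exact h0

/-- Partial derivatives falling on the two factors of a bilinear integral can be exchanged. -/
theorem integral_bilin_pd_swap (B : E →L[ℝ] F →L[ℝ] ℝ) {u : Space n → E} {v : Space n → F}
    (hu : ContDiff ℝ 1 u) (hcu : HasCompactSupport u) (hv : ContDiff ℝ 1 v) (j k : Fin n) :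
    ∫ x, B (pd j u x) (pd k v x) = ∫ x, B (pd k u x) (pd j v x) := by
  obtain ⟨r, hr⟩ := hcu.isCompact.isBounded.subset_ball_lt 0 0
  -- The bump equals one on a ball containing the support of `u`, so cutting off `v` leaves both
  -- integrands unchanged.
  let η : ContDiffBump (0 : Space n) := ⟨r, r + 1, hr.1, by linarith⟩
  have hloc : ∀ i, ∀ x ∈ tsupport u, pd i (fun y => η y • v y) x = pd i v x := by
    intro i x hx
    have : (fun y => η y • v y) =ᶠ[𝓝 x] v := by
      filter_upwards [η.eventuallyEq_one_of_mem_ball (hr.2 hx)] with y hy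
      simp [hy]
    simp only [pd, this.fderiv_eq]
  have hswap := integral_bilin_pd_swap_aux B hu hcu (η.contDiff.smul hv)
    (η.hasCompactSupport.smul_right (f' := v)) j k
  have heq : ∀ i l, ∀ x, B (pd i u x) (pd l (fun y => η y • v y) x) = B (pd i u x) (pd l v x) := by
    intro i l x
    by_cases hx : x ∈ tsupport u
    · rw [hloc l x hx]
    · simp [pd_zero_of_notMem_tsupport hx]
  calc ∫ x, B (pd j u x) (pd k v x) = ∫ x, B (pd j u x) (pd k (fun y => η y • v y) x) := by
        simp only [heq]
    _ = ∫ x, B (pd k u x) (pd j (fun y => η y • v y) x) := hswap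
    _ = _ := by simp only [heq]

end Calculus

/-! ### Gradient and Laplacian in coordinates. -/

section Laplacian

variable {n : ℕ}

theorem norm_gradient_sq {h : Space n → ℝ} (x : Space n) :
    ‖gradient h x‖ ^ 2 = ∑ j, pd j h x ^ 2 := by
  have : ∀ j, gradient h x j = pd j h x := by
    intro j
    have h1 : inner ℝ (gradient h x) (EuclideanSpace.single j (1 : ℝ)) = pd j h x := by
      simp [gradient, pd]
    rw [← h1, EuclideanSpace.inner_single_right]
    simp
  rw [EuclideanSpace.norm_sq_eq]
  simp [this]

theorem pd_pd_eq {h : Space n → ℝ} (hh : ContDiff ℝ 2 h) (j k : Fin n) (x : Space n) :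
    pd j (pd k h) x
      = fderiv ℝ (fderiv ℝ h) x (EuclideanSpace.single j 1) (EuclideanSpace.single k 1) := by
  have hd : DifferentiableAt ℝ (fderiv ℝ h) x :=
    ((hh.fderiv_right (m := 1) (by norm_num)).differentiable one_ne_zero) x
  change fderiv ℝ (fun y => fderiv ℝ h y ((fun _ => EuclideanSpace.single k (1 : ℝ)) y)) x _ = _
  rw [fderiv_clm_apply hd (by fun_prop)]
  simp

theorem laplacian_eq_sum_pd {h : Space n → ℝ} (hh : ContDiff ℝ 2 h) (x : Space n) :
    Laplacian.laplacian h x = ∑ j, pd j (pd j h) x := by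
  rw [InnerProductSpace.laplacian_eq_iteratedFDeriv_orthonormalBasis h
    (EuclideanSpace.basisFun (Fin n) ℝ)]
  simp [pd_pd_eq hh, iteratedFDeriv_two_apply]

theorem pd_pd_comm {h : Space n → ℝ} (hh : ContDiff ℝ 2 h) (j k : Fin n) (x : Space n) :
    pd j (pd k h) x = pd k (pd j h) x := by
  have hs := (hh.contDiffAt (x := x)).isSymmSndFDerivAt (by simp)
  rw [pd_pd_eq hh, pd_pd_eq hh, hs.eq]

end Laplacian

/-! ### Real sesquilinear forms and the Clifford relations. -/

section Algebra

variable {n N : ℕ}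

/-- The real bilinear form `Re (v* S w)`. -/
noncomputable def sesq (S : Matrix (Fin N) (Fin N) ℂ) :
    (Fin N → ℂ) →L[ℝ] (Fin N → ℂ) →L[ℝ] ℝ :=
  LinearMap.toContinuousBilinearMap
    (LinearMap.mk₂ ℝ (fun v w : Fin N → ℂ => (star v ⬝ᵥ S *ᵥ w).re)
      (fun v v' w => by simp [add_dotProduct])
      (fun c v w => by simp [smul_dotProduct])
      (fun v w w' => by simp [Matrix.mulVec_add, dotProduct_add])
      (fun c v w => by simp [Matrix.mulVec_smul, dotProduct_smul]))

theorem sesq_apply (S : Matrix (Fin N) (Fin N) ℂ) (v w : Fin N → ℂ) :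
    sesq S v w = (star v ⬝ᵥ S *ᵥ w).re := rfl

theorem sesq_add (S T : Matrix (Fin N) (Fin N) ℂ) (v w : Fin N → ℂ) :
    sesq (S + T) v w = sesq S v w + sesq T v w := by
  simp [sesq_apply, Matrix.add_mulVec, dotProduct_add]

theorem sesq_neg (S : Matrix (Fin N) (Fin N) ℂ) (v w : Fin N → ℂ) :
    sesq (-S) v w = -sesq S v w := by
  simp [sesq_apply, Matrix.neg_mulVec, dotProduct_neg]

theorem sesq_mulVec_right (S T : Matrix (Fin N) (Fin N) ℂ) (v w : Fin N → ℂ) :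
    sesq S v (T *ᵥ w) = sesq (S * T) v w := by
  simp [sesq_apply, Matrix.mulVec_mulVec]

theorem sesq_mulVec_left (S T : Matrix (Fin N) (Fin N) ℂ) (v w : Fin N → ℂ) :
    sesq S (T *ᵥ v) w = sesq (Tᴴ * S) v w := by
  simp only [sesq_apply, Matrix.star_mulVec, ← Matrix.mulVec_mulVec]
  rw [Matrix.dotProduct_mulVec (star v) Tᴴ]

theorem star_dotProduct_mulVec (S : Matrix (Fin N) (Fin N) ℂ) (v w : Fin N → ℂ) :
    star (star v ⬝ᵥ S *ᵥ w) = star w ⬝ᵥ Sᴴ *ᵥ v := by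
  rw [Matrix.star_dotProduct, star_star, Matrix.star_mulVec, Matrix.dotProduct_mulVec]

theorem sesq_swap (S : Matrix (Fin N) (Fin N) ℂ) (v w : Fin N → ℂ) :
    sesq S v w = sesq Sᴴ w v := by
  rw [sesq_apply, sesq_apply, ← star_dotProduct_mulVec]
  simp

theorem sesq_one_self (v : Fin N → ℂ) : sesq 1 v v = ∑ a, ‖v a‖ ^ 2 := by
  simp only [sesq_apply, Matrix.one_mulVec, dotProduct, Complex.re_sum]
  refine Finset.sum_congr rfl fun a _ => ?_
  rw [← Complex.normSq_eq_norm_sq]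
  simp [Complex.normSq_apply]

theorem sesq_one_self_nonneg (v : Fin N → ℂ) : 0 ≤ sesq 1 v v := by
  rw [sesq_one_self]; positivity

theorem sesq_one_self_eq_zero {v : Fin N → ℂ} : sesq 1 v v = 0 ↔ v = 0 := by
  rw [sesq_one_self, Finset.sum_eq_zero_iff_of_nonneg (fun _ _ => by positivity)]
  simp [funext_iff]

theorem sesq_one_add_le (v w : Fin N → ℂ) :
    sesq 1 (v + w) (v + w) ≤ 2 * sesq 1 v v + 2 * sesq 1 w w := by
  have h1 := sesq_one_self_nonneg (v - w)
  simp only [map_add, map_sub, add_apply, sub_apply] at *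
  linarith

/-- The norm on `Fin N → ℂ` is the sup norm, while `sesq 1 v v` is the squared Euclidean length used
in all L² estimates. -/
theorem norm_sq_le_sesq (v : Fin N → ℂ) : ‖v‖ ^ 2 ≤ sesq 1 v v := by
  rw [sesq_one_self]
  have h0 : 0 ≤ ∑ a, ‖v a‖ ^ 2 := by positivity
  have : ‖v‖ ≤ √(∑ a, ‖v a‖ ^ 2) := by
    refine (pi_norm_le_iff_of_nonneg (Real.sqrt_nonneg _)).2 fun a => ?_
    refine Real.le_sqrt_of_sq_le ?_
    exact Finset.single_le_sum (f := fun a => ‖v a‖ ^ 2) (fun _ _ => by positivity) (Finset.mem_univ a)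
  calc ‖v‖ ^ 2 ≤ √(∑ a, ‖v a‖ ^ 2) ^ 2 := by gcongr
    _ = _ := Real.sq_sqrt h0

theorem abs_sesq_le (S : Matrix (Fin N) (Fin N) ℂ) (v w : Fin N → ℂ) :
    |sesq S v w| ≤ ‖sesq S‖ * (sesq 1 v v + sesq 1 w w) := by
  have h1 : |sesq S v w| ≤ ‖sesq S‖ * ‖v‖ * ‖w‖ := (sesq S).le_opNorm₂ v w
  have h2 := norm_sq_le_sesq v
  have h3 := norm_sq_le_sesq w
  have h4 : ‖v‖ * ‖w‖ ≤ sesq 1 v v + sesq 1 w w := by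
    nlinarith [sq_nonneg (‖v‖ - ‖w‖), sq_nonneg ‖v‖, sq_nonneg ‖w‖]
  calc _ ≤ ‖sesq S‖ * (‖v‖ * ‖w‖) := by rw [← mul_assoc]; exact h1
    _ ≤ _ := by gcongr

theorem continuous_sesq {S : Matrix (Fin N) (Fin N) ℂ} {X : Type*} [TopologicalSpace X]
    {u v : X → Fin N → ℂ} (hu : Continuous u) (hv : Continuous v) :
    Continuous fun x => sesq S (u x) (v x) :=
  ((sesq S).continuous.comp hu).clm_apply hv

theorem contDiff_sesq {S : Matrix (Fin N) (Fin N) ℂ} {u v : Space n → Fin N → ℂ}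
    (hu : ContDiff ℝ 1 u) (hv : ContDiff ℝ 1 v) :
    ContDiff ℝ 1 fun x => sesq S (u x) (v x) :=
  ((sesq S).contDiff.comp hu).clm_apply hv

theorem integrable_sesq (S : Matrix (Fin N) (Fin N) ℂ) {u v : Space n → Fin N → ℂ}
    (hu : Continuous u) (hv : Continuous v) (hiu : Integrable fun x => sesq 1 (u x) (u x))
    (hiv : Integrable fun x => sesq 1 (v x) (v x)) :
    Integrable fun x => sesq S (u x) (v x) :=
  ((hiu.add hiv).const_mul ‖sesq S‖).mono' (continuous_sesq hu hv).aestronglyMeasurable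
    (Eventually.of_forall fun x => abs_sesq_le S (u x) (v x))

variable (A : DiracMatrices n N)

/-- The skew-adjoint matrices `-iαʲ`. -/
noncomputable def DiracMatrices.γ (j : Fin n) : Matrix (Fin N) (Fin N) ℂ := -Complex.I • A.α j

theorem γ_conjTranspose (j : Fin n) : (A.γ j)ᴴ = -A.γ j := by
  simp [DiracMatrices.γ, Matrix.conjTranspose_smul, (A.α_selfAdjoint j).eq]

theorem γ_anticomm (j k : Fin n) :
    A.γ j * A.γ k + A.γ k * A.γ j = if j = k then -2 else 0 := by
  have := A.α_anticomm j k
  simp only [DiracMatrices.γ, Matrix.smul_mul, Matrix.mul_smul, smul_smul]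
  simp only [neg_mul_neg, Complex.I_mul_I, neg_smul, one_smul, ← neg_add, this]
  split_ifs <;> simp

theorem γ_β_anticomm (j : Fin n) : A.γ j * A.β = -(A.β * A.γ j) := by
  have := eq_neg_of_add_eq_zero_left (A.α_β_anticomm j)
  simp [DiracMatrices.γ, this]

theorem diracOp_eq (φ : Space n → Fin N → ℂ) (x : Space n) :
    diracOp A φ x = ∑ j, A.γ j *ᵥ pd j φ x := by
  simp only [diracOp, DiracMatrices.γ, pd, Finset.smul_sum, Matrix.smul_mulVec]

theorem sesq_sum_sum (S : Matrix (Fin N) (Fin N) ℂ) {ι κ : Type*} (s : Finset ι) (t : Finset κ)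
    (v : ι → Fin N → ℂ) (w : κ → Fin N → ℂ) :
    sesq S (∑ i ∈ s, v i) (∑ k ∈ t, w k) = ∑ i ∈ s, ∑ k ∈ t, sesq S (v i) (w k) := by
  simp only [map_sum, sum_apply]
  exact Finset.sum_comm

theorem sesq_γ_sum (v w : Fin n → Fin N → ℂ) :
    sesq 1 (∑ j, A.γ j *ᵥ v j) (∑ j, A.γ j *ᵥ w j)
      = -∑ j, ∑ k, sesq (A.γ j * A.γ k) (v j) (w k) := by
  rw [sesq_sum_sum, ← Finset.sum_neg_distrib]
  refine Finset.sum_congr rfl fun j _ => ?_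
  rw [← Finset.sum_neg_distrib]
  refine Finset.sum_congr rfl fun k _ => ?_
  rw [sesq_mulVec_right, sesq_mulVec_left, γ_conjTranspose, one_mul, neg_mul, sesq_neg]

/-- Symmetric sums against products of Dirac matrices are diagonal. -/
theorem sum_γ_mul_of_symm (b : Fin n → Fin n → Matrix (Fin N) (Fin N) ℂ → ℝ)
    (hadd : ∀ j k S T, b j k (S + T) = b j k S + b j k T)
    (hneg : ∀ j k S, b j k (-S) = -b j k S)
    (hsymm : ∀ j k S, b j k S = b k j S) :
    -∑ j, ∑ k, b j k (A.γ j * A.γ k) = ∑ j, b j j 1 := by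
  have h1 : ∑ j, ∑ k, b j k (A.γ j * A.γ k) = ∑ j, ∑ k, b j k (A.γ k * A.γ j) := by
    rw [Finset.sum_comm]
    exact Finset.sum_congr rfl fun j _ => Finset.sum_congr rfl fun k _ => hsymm k j _
  have hz : ∀ j k, b j k 0 = 0 := fun j k => by
    have := hadd j k 0 0
    simp at this; exact this
  have h2 : ∑ j, ∑ k, b j k (A.γ j * A.γ k) + ∑ j, ∑ k, b j k (A.γ k * A.γ j)
      = ∑ j, -(2 * b j j 1) := by
    rw [← Finset.sum_add_distrib]
    refine Finset.sum_congr rfl fun j _ => ?_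
    rw [← Finset.sum_add_distrib]
    simp only [← hadd, γ_anticomm]
    rw [Finset.sum_eq_single j]
    · rw [if_pos rfl, ← one_add_one_eq_two, neg_add, hadd, hneg]; ring
    · intro k _ hk; rw [if_neg (Ne.symm hk), hz]
    · simp
  rw [Finset.sum_neg_distrib, ← Finset.mul_sum] at h2
  linarith

end Algebra

/-! ### Cutoff functions at scale R. -/

section Cutoff

variable {n : ℕ} {E : Type*} [NormedAddCommGroup E] [NormedSpace ℝ E]

theorem pd_comp_smul {f : Space n → E} (hf : Differentiable ℝ f) (c : ℝ) (j : Fin n)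
    (x : Space n) : pd j (fun y => f (c • y)) x = c • pd j f (c • x) := by
  have hd : HasFDerivAt (fun y => f (c • y)) _ x :=
    (hf (c • x)).hasFDerivAt.comp x ((hasFDerivAt_id (𝕜 := ℝ) x).const_smul c)
  simp only [pd]
  rw [hd.fderiv]
  simp

theorem contDiff_comp_smul {f : Space n → E} {m : WithTop ℕ∞} (hf : ContDiff ℝ m f) (c : ℝ) :
    ContDiff ℝ m fun y => f (c • y) :=
  hf.comp (contDiff_const_smul c)

theorem hasCompactSupport_comp_smul {E : Type*} [NormedAddCommGroup E] {f : Space n → E} (hf : HasCompactSupport f) {c : ℝ}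
    (hc : c ≠ 0) : HasCompactSupport fun y => f (c • y) :=
  hf.comp_homeomorph (Homeomorph.smulOfNeZero c hc)

theorem exists_bound_pd {f : Space n → E} (hf : ContDiff ℝ 1 f) (hc : HasCompactSupport f) :
    ∃ C, 0 ≤ C ∧ ∀ j x, ‖pd j f x‖ ≤ C := by
  have : ∀ j, ∃ C, ∀ x, ‖pd j f x‖ ≤ C := fun j =>
    (hasCompactSupport_pd hc j).exists_bound_of_continuous (continuous_pd hf j)
  choose C hC using this
  refine ⟨∑ j, |C j|, by positivity, fun j x => (hC j x).trans ((le_abs_self _).trans ?_)⟩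
  exact Finset.single_le_sum (f := fun j => |C j|) (fun _ _ => abs_nonneg _) (Finset.mem_univ j)

variable (n) in
/-- A smooth bump function equal to one on the unit ball. -/
noncomputable def bump : ContDiffBump (0 : Space n) := ⟨1, 2, one_pos, one_lt_two⟩

/-- The cutoff function at scale `R`. -/
noncomputable def cutoff (R : ℝ) (x : Space n) : ℝ := bump n (R⁻¹ • x)

theorem contDiff_cutoff (R : ℝ) {m : ℕ∞} : ContDiff ℝ m (cutoff (n := n) R) :=
  contDiff_comp_smul (bump n).contDiff _

theorem hasCompactSupport_cutoff {R : ℝ} (hR : 0 < R) : HasCompactSupport (cutoff (n := n) R) :=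
  hasCompactSupport_comp_smul (bump n).hasCompactSupport (inv_ne_zero hR.ne')

theorem cutoff_nonneg (R : ℝ) (x : Space n) : 0 ≤ cutoff R x := (bump n).nonneg

theorem cutoff_le_one (R : ℝ) (x : Space n) : cutoff R x ≤ 1 := (bump n).le_one

theorem pd_cutoff (R : ℝ) (j : Fin n) (x : Space n) :
    pd j (cutoff R) x = R⁻¹ * pd j (bump n) (R⁻¹ • x) :=
  pd_comp_smul ((bump n).contDiff.differentiable (n := 1) one_ne_zero) _ _ _

theorem cutoff_eventuallyEq_one {R : ℝ} (hR : 0 < R) {x : Space n} (hx : ‖x‖ < R) :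
    cutoff R =ᶠ[𝓝 x] fun _ => 1 := by
  have hx' : R⁻¹ • x ∈ Metric.ball (0 : Space n) (bump n).rIn := by
    rw [mem_ball_zero_iff, norm_smul, norm_inv, Real.norm_of_nonneg hR.le]
    change R⁻¹ * ‖x‖ < 1
    rwa [inv_mul_lt_one₀ hR]
  exact ((continuous_const_smul R⁻¹).tendsto x).eventually
    ((bump n).eventuallyEq_one_of_mem_ball hx')

theorem pd_cutoff_smul_of_norm_lt {R : ℝ} (hR : 0 < R) {x : Space n} (hx : ‖x‖ < R)
    (f : Space n → E) (j : Fin n) : pd j (fun y => cutoff R y • f y) x = pd j f x := by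
  have : (fun y => cutoff R y • f y) =ᶠ[𝓝 x] f := by
    filter_upwards [cutoff_eventuallyEq_one hR hx] with y hy
    simp [hy]
  simp only [pd, this.fderiv_eq]

theorem pd_cutoff_of_norm_lt {R : ℝ} (hR : 0 < R) {x : Space n} (hx : ‖x‖ < R) (j : Fin n) :
    pd j (cutoff R) x = 0 := by
  simp [pd, (cutoff_eventuallyEq_one hR hx).fderiv_eq]

theorem tendsto_cutoff (x : Space n) : Tendsto (fun R : ℝ => cutoff R x) atTop (𝓝 1) := by
  refine tendsto_const_nhds.congr' ?_
  filter_upwards [eventually_gt_atTop (0 : ℝ), eventually_gt_atTop ‖x‖] with R h0 h1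
  exact (cutoff_eventuallyEq_one h0 h1).self_of_nhds.symm

theorem cutoff_eq_zero {R : ℝ} (hR : 0 < R) {x : Space n} (hx : 2 * R ≤ ‖x‖) :
    cutoff R x = 0 := by
  refine (bump n).zero_of_le_dist ?_
  rw [dist_zero_right, norm_smul, norm_inv, Real.norm_of_nonneg hR.le, le_inv_mul_iff₀ hR]
  change R * 2 ≤ ‖x‖
  linarith

variable (n) in
theorem exists_bound_pd_cutoff :
    ∃ C, 0 ≤ C ∧ ∀ (R : ℝ), 0 < R → ∀ j (x : Space n), |pd j (cutoff R) x| ≤ C / R := by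
  obtain ⟨C, hC0, hC⟩ := exists_bound_pd (bump n).contDiff (bump n).hasCompactSupport
  refine ⟨C, hC0, fun R hR j x => ?_⟩
  rw [pd_cutoff, abs_mul, abs_of_pos (inv_pos.2 hR), inv_mul_eq_div]
  gcongr
  exact hC j _

theorem tendsto_integral_cutoff_mul {f : Space n → ℝ} (hf : Integrable f) :
    Tendsto (fun R : ℝ => ∫ x, cutoff R x * f x) atTop (𝓝 (∫ x, f x)) := by
  refine tendsto_integral_filter_of_dominated_convergence (fun x => ‖f x‖)
    (Eventually.of_forall fun R => (contDiff_cutoff R (m := 0)).continuous.aestronglyMeasurable.mul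
      hf.aestronglyMeasurable) ?_ hf.norm ?_
  · refine Eventually.of_forall fun R => Eventually.of_forall fun x => ?_
    rw [norm_mul, Real.norm_of_nonneg (cutoff_nonneg R x)]
    exact mul_le_of_le_one_left (norm_nonneg _) (cutoff_le_one R x)
  · refine Eventually.of_forall fun x => ?_
    simpa using (tendsto_cutoff x).mul_const (f x)

end Cutoff

/-! ### L² control of the gradient by the Dirac operator. -/

section GradientEstimate

variable {n N : ℕ} (A : DiracMatrices n N)

theorem continuous_diracOp {φ : Space n → Fin N → ℂ} (hφ : ContDiff ℝ 1 φ) :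
    Continuous (diracOp A φ) := by
  rw [show diracOp A φ = fun x => ∑ j, A.γ j *ᵥ pd j φ x from funext (diracOp_eq A φ)]
  exact continuous_finsetSum _ fun j _ => continuous_const.matrix_mulVec (continuous_pd hφ j)

/-- This is D₀² = -Δ in weak form: the matrix of integrals of ∂ⱼu against ∂ₖu is symmetric by the
exchange of derivatives, so only the anticommutators of the Dirac matrices survive. -/
theorem integral_sesq_diracOp_eq {u : Space n → Fin N → ℂ} (hu : ContDiff ℝ 1 u)
    (hc : HasCompactSupport u) :
    ∫ x, sesq 1 (diracOp A u x) (diracOp A u x) = ∑ j, ∫ x, sesq 1 (pd j u x) (pd j u x) := by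
  have hi : ∀ j k S, Integrable fun x => sesq S (pd j u x) (pd k u x) := fun j k S =>
    (continuous_sesq (continuous_pd hu j) (continuous_pd hu k)).integrable_of_hasCompactSupport <|
      (hasCompactSupport_pd hc j).mono fun x hx => by
        contrapose! hx
        simp only [Function.mem_support, not_not] at hx ⊢
        simp [hx]
  rw [← sum_γ_mul_of_symm A (fun j k S => ∫ x, sesq S (pd j u x) (pd k u x))
    (fun j k S T => by simp only [sesq_add]; exact integral_add (hi j k S) (hi j k T))
    (fun j k S => by simp only [sesq_neg]; exact integral_neg _)
    (fun j k S => integral_bilin_pd_swap (sesq S) hu hc hu j k)]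
  simp only [diracOp_eq, sesq_γ_sum]
  rw [integral_neg, integral_finsetSum _ fun j _ => integrable_finsetSum _ fun k _ => hi j k _]
  congr 1
  exact Finset.sum_congr rfl fun j _ => integral_finsetSum _ fun k _ => hi j k _

theorem diracOp_smul {f : Space n → ℝ} {φ : Space n → Fin N → ℂ} {x : Space n}
    (hf : DifferentiableAt ℝ f x) (hφ : DifferentiableAt ℝ φ x) :
    diracOp A (fun y => f y • φ y) x
      = ∑ j, A.γ j *ᵥ (pd j f x • φ x) + f x • diracOp A φ x := by
  simp only [diracOp_eq, pd_smul hf hφ, Matrix.mulVec_add, Finset.sum_add_distrib, Finset.smul_sum,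
    Matrix.mulVec_smul]

/-- The Clifford identity |α·c v|² = |c|²|v|², which bounds the commutator of D₀ with a cutoff. -/
theorem sesq_γ_sum_smul (c : Fin n → ℝ) (v : Fin N → ℂ) :
    sesq 1 (∑ j, A.γ j *ᵥ (c j • v)) (∑ j, A.γ j *ᵥ (c j • v)) = (∑ j, c j ^ 2) * sesq 1 v v := by
  rw [sesq_γ_sum, sum_γ_mul_of_symm A (fun j k S => sesq S (c j • v) (c k • v))
    (fun j k S T => sesq_add _ _ _ _) (fun j k S => sesq_neg _ _ _)
    (fun j k S => by simp only [map_smul, smul_apply, smul_eq_mul]; ring), Finset.sum_mul]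
  refine Finset.sum_congr rfl fun j _ => ?_
  simp only [map_smul, smul_apply, smul_eq_mul]; ring

/-- The gradient of an `L²` spinor is controlled in `L²` by its Dirac derivative. -/
theorem integrable_pd_of_diracOp {φ : Space n → Fin N → ℂ} (hφ : ContDiff ℝ 1 φ)
    (h0 : Integrable fun x => sesq 1 (φ x) (φ x))
    (h1 : Integrable fun x => sesq 1 (diracOp A φ x) (diracOp A φ x)) :
    (Integrable fun x => ∑ j, sesq 1 (pd j φ x) (pd j φ x)) ∧
      ∫ x, ∑ j, sesq 1 (pd j φ x) (pd j φ x)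
        ≤ 2 * ∫ x, sesq 1 (diracOp A φ x) (diracOp A φ x) := by
  set f : Space n → ℝ := fun x => ∑ j, sesq 1 (pd j φ x) (pd j φ x) with hf
  have hfc : Continuous f := continuous_finsetSum _ fun j _ =>
    continuous_sesq (continuous_pd hφ j) (continuous_pd hφ j)
  have hf0 : ∀ x, 0 ≤ f x := fun x => Finset.sum_nonneg fun j _ => sesq_one_self_nonneg _
  obtain ⟨C, hC0, hC⟩ := exists_bound_pd_cutoff n
  set I0 := ∫ x, sesq 1 (φ x) (φ x)
  set I1 := ∫ x, sesq 1 (diracOp A φ x) (diracOp A φ x)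
  -- Apply the compactly supported identity to the cutoff spinor. The factors 2 come from |a + b|² ≤
  -- 2|a|² + 2|b|²; the commutator term is O(R⁻²) and disappears as R → ∞.
  have hbd : ∀ R : ℝ, 0 < R →
      ∫ x in Metric.ball (0 : Space n) R, f x ≤ 2 * (n * (C / R) ^ 2 * I0) + 2 * I1 := by
    intro R hR
    set u : Space n → Fin N → ℂ := fun y => cutoff R y • φ y with hu
    have hu1 : ContDiff ℝ 1 u := (contDiff_cutoff R (m := 1)).smul hφ
    have huc : HasCompactSupport u := (hasCompactSupport_cutoff hR).smul_right
    have hui : ∀ j, Integrable fun x => sesq 1 (pd j u x) (pd j u x) := fun j =>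
      (continuous_sesq (continuous_pd hu1 j) (continuous_pd hu1 j)).integrable_of_hasCompactSupport
        ((hasCompactSupport_pd huc j).comp_left (g := fun v => sesq 1 v v) (by simp))
    have hui' : Integrable fun x => ∑ j, sesq 1 (pd j u x) (pd j u x) :=
      integrable_finsetSum _ fun j _ => hui j
    calc ∫ x in Metric.ball (0 : Space n) R, f x
        = ∫ x in Metric.ball (0 : Space n) R, ∑ j, sesq 1 (pd j u x) (pd j u x) := by
          refine setIntegral_congr_fun Metric.isOpen_ball.measurableSet fun x hx => ?_
          simp only [hf, hu]
          refine Finset.sum_congr rfl fun j _ => ?_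
          rw [pd_cutoff_smul_of_norm_lt hR (mem_ball_zero_iff.1 hx)]
      _ ≤ ∫ x, ∑ j, sesq 1 (pd j u x) (pd j u x) :=
          setIntegral_le_integral hui' (Eventually.of_forall fun x =>
            Finset.sum_nonneg fun j _ => sesq_one_self_nonneg _)
      _ = ∫ x, sesq 1 (diracOp A u x) (diracOp A u x) := by
          rw [integral_sesq_diracOp_eq A hu1 huc, integral_finsetSum _ fun j _ => hui j]
      _ ≤ ∫ x, (2 * (n * (C / R) ^ 2 * sesq 1 (φ x) (φ x))
            + 2 * sesq 1 (diracOp A φ x) (diracOp A φ x)) := by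
          refine integral_mono_of_nonneg (Eventually.of_forall fun x => sesq_one_self_nonneg _)
            (((h0.const_mul _).const_mul _).add (h1.const_mul _)) (Eventually.of_forall fun x => ?_)
          simp only [hu]
          rw [diracOp_smul A ((contDiff_cutoff R (m := 1)).differentiable one_ne_zero x)
            (hφ.differentiable one_ne_zero x)]
          refine (sesq_one_add_le _ _).trans ?_
          rw [sesq_γ_sum_smul]
          have e1 : ∑ j, pd j (cutoff R) x ^ 2 ≤ n * (C / R) ^ 2 := by
            calc ∑ j, pd j (cutoff R) x ^ 2 ≤ ∑ _j : Fin n, (C / R) ^ 2 :=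
                  Finset.sum_le_sum fun j _ => sq_le_sq' (abs_le.1 (hC R hR j x)).1
                    (abs_le.1 (hC R hR j x)).2
              _ = _ := by simp
          have e2 : sesq 1 (cutoff R x • diracOp A φ x) (cutoff R x • diracOp A φ x)
              ≤ sesq 1 (diracOp A φ x) (diracOp A φ x) := by
            simp only [map_smul, smul_apply, smul_eq_mul]
            have a0 := cutoff_nonneg R x
            have a1 := cutoff_le_one R x
            have a2 := sesq_one_self_nonneg (diracOp A φ x)
            rw [← mul_assoc]
            exact mul_le_of_le_one_left a2 (by nlinarith)
          have a3 := sesq_one_self_nonneg (φ x)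
          gcongr
      _ = _ := by
          rw [integral_add ((h0.const_mul _).const_mul _) (h1.const_mul _), integral_const_mul,
            integral_const_mul, integral_const_mul]
  have hI0 : 0 ≤ I0 := integral_nonneg fun x => sesq_one_self_nonneg _
  have hcov : AECover (volume : Measure (Space n)) atTop
      (fun R : ℝ => Metric.ball (0 : Space n) R) := aecover_ball tendsto_id
  have hint : Integrable f := by
    refine hcov.integrable_of_integral_norm_bounded (2 * (n * C ^ 2 * I0) + 2 * I1)
      (fun R => (hfc.continuousOn.integrableOn_compact
        (isCompact_closedBall (0 : Space n) R)).mono_set Metric.ball_subset_closedBall) ?_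
    filter_upwards [eventually_ge_atTop (1 : ℝ)] with R hR
    simp only [Real.norm_of_nonneg (hf0 _)]
    refine (hbd R (by linarith)).trans ?_
    have : C / R ≤ C := div_le_self hC0 hR
    have : 0 ≤ C / R := by positivity
    gcongr
  refine ⟨hint, ?_⟩
  have hlim : Tendsto (fun R : ℝ => 2 * (n * (C / R) ^ 2 * I0) + 2 * I1) atTop (𝓝 (2 * I1)) := by
    have : Tendsto (fun R : ℝ => C / R) atTop (𝓝 0) := tendsto_const_nhds.div_atTop tendsto_id
    simpa using ((((this.pow 2).const_mul (n : ℝ)).mul_const I0).const_mul 2).add_const (2 * I1)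
  refine le_of_tendsto_of_tendsto (hcov.integral_tendsto_of_countably_generated hint) hlim ?_
  filter_upwards [eventually_gt_atTop (0 : ℝ)] with R hR using hbd R hR

end GradientEstimate

/-! ### The stationary system, its stress tensor and truncated dilations. -/

section Virial

variable {n N : ℕ}

/-- A localized solution of the stationary system, with all identities written in real terms. -/
structure IsStationary (A : DiracMatrices n N) (p : Params) (ω : ℝ)
    (φ : Space n → Fin N → ℂ) (h : Space n → ℝ) : Prop where
  contDiff_spinor : ContDiff ℝ 1 φ
  contDiff_scalar : ContDiff ℝ 2 h
  dirac : ∀ x, diracOp A φ x = ω • φ x - (p.m - p.g * h x) • (A.β *ᵥ φ x)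
  kleinGordon : ∀ x, -∑ j, pd j (pd j h) x + p.M ^ 2 * h x = sesq A.β (φ x) (φ x)
  integrable_spinor : Integrable fun x => sesq 1 (φ x) (φ x)
  bounded_scalar : ∃ C : ℝ, ∀ x, |h x| ≤ C
  integrable_gradient : Integrable fun x => ∑ j, pd j h x ^ 2
  integrable_mass : Integrable fun x => p.M ^ 2 * h x ^ 2

/-- The stress tensor of the stationary system. -/
noncomputable def stress (A : DiracMatrices n N) (p : Params) (φ : Space n → Fin N → ℂ)
    (h : Space n → ℝ) (j k : Fin n) (x : Space n) : ℝ :=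
  sesq (A.γ j) (φ x) (pd k φ x) + p.g * (pd k h x * pd j h x)
    - if j = k then p.g / 2 * (∑ i, pd i h x ^ 2 + p.M ^ 2 * h x ^ 2) else 0

variable {A : DiracMatrices n N} {p : Params} {ω : ℝ} {φ : Space n → Fin N → ℂ}
  {h : Space n → ℝ}

theorem sum_sesq_γ_right (v : Fin N → ℂ) (x : Space n) :
    ∑ j, sesq (A.γ j) v (pd j φ x) = sesq 1 v (diracOp A φ x) := by
  simp [diracOp_eq, map_sum, sesq_mulVec_right]

theorem sesq_one_comm (v w : Fin N → ℂ) : sesq 1 v w = sesq 1 w v := by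
  rw [sesq_swap, Matrix.conjTranspose_one]

theorem sesq_β_comm (v w : Fin N → ℂ) : sesq A.β v w = sesq A.β w v := by
  rw [sesq_swap, A.β_selfAdjoint.eq]

theorem sum_sesq_γ_left (w : Fin N → ℂ) (x : Space n) :
    ∑ j, sesq (A.γ j) (pd j φ x) w = -sesq 1 w (diracOp A φ x) := by
  rw [← sum_sesq_γ_right, ← Finset.sum_neg_distrib]
  refine Finset.sum_congr rfl fun j _ => ?_
  rw [sesq_swap, γ_conjTranspose, sesq_neg]

theorem IsStationary.sesq_diracOp (H : IsStationary A p ω φ h) (v : Fin N → ℂ) (x : Space n) :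
    sesq 1 v (diracOp A φ x)
      = ω * sesq 1 v (φ x) - (p.m - p.g * h x) * sesq A.β v (φ x) := by
  rw [H.dirac]
  simp only [map_sub, map_smul, sesq_mulVec_right, smul_eq_mul, one_mul]

/-- A pointwise form of the conservation law in which φ is differentiated only once: up to exact
derivatives, the remainder is antisymmetric in the two derivatives of X φ and φ, hence has zero
integral by the exchange lemma. Formally it would be X times the divergence of the stress. -/
theorem IsStationary.sum_pd_mul_stress (H : IsStationary A p ω φ h) {X : Space n → ℝ}
    (hX : ContDiff ℝ 1 X) (k : Fin n) (x : Space n) :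
    ∑ j, pd j X x * stress A p φ h j k x
      = pd k (fun y => X y * (ω * sesq 1 (φ y) (φ y)
          - (p.m - p.g * h y) * sesq A.β (φ y) (φ y))) x
        - ∑ j, (sesq (A.γ j) (pd k (fun y => X y • φ y) x) (pd j φ x)
            - sesq (A.γ j) (pd j (fun y => X y • φ y) x) (pd k φ x))
        + p.g * ∑ j, pd j (fun y => X y * (pd k h y * pd j h y)) x
        - p.g / 2 * ∑ j, pd k (fun y => X y * (pd j h y * pd j h y)) x
        - p.g / 2 * p.M ^ 2 * pd k (fun y => X y * (h y * h y)) x := by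
  have hXd : DifferentiableAt ℝ X x := hX.differentiable one_ne_zero x
  have hφd : DifferentiableAt ℝ φ x := H.contDiff_spinor.differentiable one_ne_zero x
  have hhd : DifferentiableAt ℝ h x := H.contDiff_scalar.differentiable two_ne_zero x
  have hpd : ∀ j, DifferentiableAt ℝ (pd j h) x := fun j =>
    (contDiff_pd H.contDiff_scalar j).differentiable one_ne_zero x
  have hsd : ∀ S, DifferentiableAt ℝ (fun y => sesq S (φ y) (φ y)) x := fun S =>
    (contDiff_sesq H.contDiff_spinor H.contDiff_spinor).differentiable one_ne_zero x
  have hw : DifferentiableAt ℝ (fun y => p.m - p.g * h y) x := by fun_prop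
  have e1 : pd k (fun y => X y * (ω * sesq 1 (φ y) (φ y)
          - (p.m - p.g * h y) * sesq A.β (φ y) (φ y))) x
      = pd k X x * (ω * sesq 1 (φ x) (φ x) - (p.m - p.g * h x) * sesq A.β (φ x) (φ x))
        + X x * (2 * sesq 1 (pd k φ x) (diracOp A φ x)
          + p.g * pd k h x * sesq A.β (φ x) (φ x)) := by
    rw [pd_mul hXd (((hsd 1).const_mul ω).fun_sub (hw.fun_mul (hsd A.β))), H.sesq_diracOp]
    congr 2
    have d1 : pd k (fun y => ω * sesq 1 (φ y) (φ y)
          - (p.m - p.g * h y) * sesq A.β (φ y) (φ y)) x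
        = ω * pd k (fun y => sesq 1 (φ y) (φ y)) x
          - pd k (fun y => (p.m - p.g * h y) * sesq A.β (φ y) (φ y)) x := by
      simp only [pd]
      rw [fderiv_fun_sub ((hsd 1).const_mul ω) (hw.fun_mul (hsd A.β)), fderiv_const_mul (hsd 1)]
      simp
    have d2 : pd k (fun y => p.m - p.g * h y) x = -(p.g * pd k h x) := by
      simp only [pd]
      rw [fderiv_const_sub, fderiv_const_mul hhd]
      simp
    rw [d1, pd_mul hw (hsd A.β), d2, pd_bilin _ hφd hφd, pd_bilin _ hφd hφd,
      sesq_one_comm (φ x), sesq_β_comm (φ x) (pd k φ x)]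
    ring
  have e2 : ∑ j, (sesq (A.γ j) (pd k (fun y => X y • φ y) x) (pd j φ x)
            - sesq (A.γ j) (pd j (fun y => X y • φ y) x) (pd k φ x))
      = pd k X x * sesq 1 (φ x) (diracOp A φ x) + 2 * X x * sesq 1 (pd k φ x) (diracOp A φ x)
        - ∑ j, pd j X x * sesq (A.γ j) (φ x) (pd k φ x) := by
    rw [Finset.sum_sub_distrib, sum_sesq_γ_right]
    simp only [pd_smul hXd hφd, map_add, map_smul, add_apply, smul_apply, smul_eq_mul,
      Finset.sum_add_distrib, ← Finset.mul_sum, sum_sesq_γ_left]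
    ring
  have e3 : ∑ j, pd j (fun y => X y * (pd k h y * pd j h y)) x
      = ∑ j, pd j X x * (pd k h x * pd j h x) + X x * ∑ j, pd k (pd j h) x * pd j h x
        + X x * pd k h x * ∑ j, pd j (pd j h) x := by
    simp only [Finset.mul_sum, ← Finset.sum_add_distrib]
    refine Finset.sum_congr rfl fun j _ => ?_
    rw [pd_mul hXd ((hpd k).fun_mul (hpd j)), pd_mul (hpd k) (hpd j),
      pd_pd_comm H.contDiff_scalar j k]
    ring
  have e4 : ∑ j, pd k (fun y => X y * (pd j h y * pd j h y)) x
      = pd k X x * ∑ j, pd j h x ^ 2 + 2 * X x * ∑ j, pd k (pd j h) x * pd j h x := by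
    simp only [Finset.mul_sum, ← Finset.sum_add_distrib]
    refine Finset.sum_congr rfl fun j _ => ?_
    rw [pd_mul hXd ((hpd j).fun_mul (hpd j)), pd_mul (hpd j) (hpd j)]
    ring
  have e5 : pd k (fun y => X y * (h y * h y)) x
      = pd k X x * h x ^ 2 + 2 * X x * h x * pd k h x := by
    rw [pd_mul hXd (hhd.fun_mul hhd), pd_mul hhd hhd]
    ring
  have e6 : ∑ j, pd j X x * stress A p φ h j k x
      = ∑ j, pd j X x * sesq (A.γ j) (φ x) (pd k φ x)
        + p.g * ∑ j, pd j X x * (pd k h x * pd j h x)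
        - pd k X x * (p.g / 2 * (∑ i, pd i h x ^ 2 + p.M ^ 2 * h x ^ 2)) := by
    simp only [stress, mul_sub, mul_add, Finset.sum_sub_distrib, Finset.sum_add_distrib, mul_ite,
      mul_zero, Finset.sum_ite_eq', Finset.mem_univ, if_true]
    congr 2
    rw [Finset.mul_sum]
    exact Finset.sum_congr rfl fun j _ => by ring
  rw [e1, e2, e3, e4, e5, e6, H.sesq_diracOp (φ x)]
  -- After the Dirac equation is used, what is left is the Klein–Gordon equation multiplied by g X
  -- ∂ₖh.
  linear_combination (p.g * X x * pd k h x) * H.kleinGordon x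

/-- The stress tensor is divergence free. -/
theorem IsStationary.integral_pd_mul_stress (H : IsStationary A p ω φ h) {X : Space n → ℝ}
    (hX : ContDiff ℝ 1 X) (hc : HasCompactSupport X) (k : Fin n) :
    ∫ x, ∑ j, pd j X x * stress A p φ h j k x = 0 := by
  have hφ := H.contDiff_spinor
  have hh : ContDiff ℝ 1 h := H.contDiff_scalar.of_le (by norm_num)
  have hp : ∀ j, ContDiff ℝ 1 (pd j h) := contDiff_pd H.contDiff_scalar
  have key : ∀ f : Space n → ℝ, ContDiff ℝ 1 f → ∀ i : Fin n,
      Integrable (pd i fun y => X y * f y) ∧ ∫ x, pd i (fun y => X y * f y) x = 0 :=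
    fun f hf i => ⟨(continuous_pd (hX.mul hf) i).integrable_of_hasCompactSupport
      (hasCompactSupport_pd hc.mul_right i),
      integral_pd_eq_zero_of_hasCompactSupport (hX.mul hf) hc.mul_right i⟩
  have hu : ContDiff ℝ 1 fun y => X y • φ y := hX.smul hφ
  have hcu : HasCompactSupport fun y => X y • φ y := hc.smul_right
  have hs : ∀ j i l, Integrable fun x =>
      sesq (A.γ j) (pd i (fun y => X y • φ y) x) (pd l φ x) := fun j i l =>
    (continuous_sesq (continuous_pd hu i) (continuous_pd hφ l)).integrable_of_hasCompactSupport <|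
      (hasCompactSupport_pd hcu i).mono fun x hx => by
        contrapose! hx
        simp only [Function.mem_support, not_not] at hx ⊢
        simp [hx]
  have k1 := key (fun y => ω * sesq 1 (φ y) (φ y) - (p.m - p.g * h y) * sesq A.β (φ y) (φ y))
    ((contDiff_const.mul (contDiff_sesq hφ hφ)).sub
      ((contDiff_const.sub (contDiff_const.mul hh)).mul (contDiff_sesq hφ hφ))) k
  have k2 : ∀ j, _ := fun j => key (fun y => pd k h y * pd j h y) ((hp k).mul (hp j)) j
  have k3 : ∀ j, _ := fun j => key (fun y => pd j h y * pd j h y) ((hp j).mul (hp j)) k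
  have k4 := key (fun y => h y * h y) (hh.mul hh) k
  have i2 : Integrable fun x => ∑ j, (sesq (A.γ j) (pd k (fun y => X y • φ y) x) (pd j φ x)
            - sesq (A.γ j) (pd j (fun y => X y • φ y) x) (pd k φ x)) :=
    integrable_finsetSum _ fun j _ => (hs j k j).sub (hs j j k)
  have i3 : Integrable fun x => p.g * ∑ j, pd j (fun y => X y * (pd k h y * pd j h y)) x :=
    (integrable_finsetSum _ fun j _ => (k2 j).1).const_mul _
  have i4 : Integrable fun x => p.g / 2 * ∑ j, pd k (fun y => X y * (pd j h y * pd j h y)) x :=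
    (integrable_finsetSum _ fun j _ => (k3 j).1).const_mul _
  have i5 := k4.1.const_mul (p.g / 2 * p.M ^ 2)
  simp only [H.sum_pd_mul_stress hX k]
  rw [integral_sub (((k1.1.sub' i2).fun_add i3).sub' i4) i5,
    integral_sub ((k1.1.sub' i2).fun_add i3) i4, integral_add (k1.1.sub' i2) i3, integral_sub k1.1 i2, integral_const_mul, integral_const_mul,
    integral_const_mul, integral_finsetSum _ fun j _ => (hs j k j).sub' (hs j j k),
    integral_finsetSum _ fun j _ => (k2 j).1, integral_finsetSum _ fun j _ => (k3 j).1, k1.2, k4.2]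
  simp only [k2, k3]
  rw [Finset.sum_eq_zero fun j _ => ?_]
  · simp
  · rw [integral_sub (hs j k j) (hs j j k),
      integral_bilin_pd_swap (sesq (A.γ j)) hu hcu hφ, sub_self]

/-- Dilation field truncated to a ball of radius of order `R`. -/
noncomputable def dilation (R : ℝ) (k : Fin n) (x : Space n) : ℝ :=
  R * (fun y : Space n => bump n y * y k) (R⁻¹ • x)

theorem contDiff_bump_mul_coord (k : Fin n) : ContDiff ℝ 1 fun y : Space n => bump n y * y k :=
  (bump n).contDiff.mul (by fun_prop)

theorem hasCompactSupport_bump_mul_coord (k : Fin n) :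
    HasCompactSupport fun y : Space n => bump n y * y k :=
  (bump n).hasCompactSupport.mul_right

theorem contDiff_dilation (R : ℝ) (k : Fin n) : ContDiff ℝ 1 (dilation R k) :=
  contDiff_const.mul (contDiff_comp_smul (contDiff_bump_mul_coord k) R⁻¹)

theorem hasCompactSupport_dilation {R : ℝ} (hR : 0 < R) (k : Fin n) :
    HasCompactSupport (dilation R k) :=
  (hasCompactSupport_comp_smul (hasCompactSupport_bump_mul_coord k) (inv_ne_zero hR.ne')).mul_left

theorem pd_dilation {R : ℝ} (hR : 0 < R) (j k : Fin n) (x : Space n) :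
    pd j (dilation R k) x = pd j (fun y : Space n => bump n y * y k) (R⁻¹ • x) := by
  have hd := (contDiff_comp_smul (contDiff_bump_mul_coord k) R⁻¹).differentiable one_ne_zero x
  have h1 : pd j (dilation R k) x
      = R * pd j (fun x => (fun y : Space n => bump n y * y k) (R⁻¹ • x)) x := by
    change fderiv ℝ (fun y => R * (fun y : Space n => bump n y * y k) (R⁻¹ • y)) x _ = _
    rw [fderiv_const_mul hd]
    rfl
  rw [h1, pd_comp_smul ((contDiff_bump_mul_coord k).differentiable one_ne_zero), smul_eq_mul,
    ← mul_assoc, mul_inv_cancel₀ hR.ne', one_mul]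

theorem pd_bump_mul_coord_zero (j k : Fin n) :
    pd j (fun y : Space n => bump n y * y k) 0 = if j = k then 1 else 0 := by
  have : (fun y : Space n => bump n y * y k) =ᶠ[𝓝 0] EuclideanSpace.proj (𝕜 := ℝ) k := by
    filter_upwards [(bump n).eventuallyEq_one] with y hy
    simp [hy]
  simp only [pd, this.fderiv_eq, ContinuousLinearMap.fderiv]
  simp [eq_comm]

/-- The derivatives of the truncated dilation are a fixed bounded function evaluated at x/R, so they
are bounded uniformly in R and tend pointwise to δⱼₖ. Dominated convergence applies to any
integrable weight, with no decay rate needed. -/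
theorem tendsto_integral_pd_dilation_mul {f : Space n → ℝ} (hf : Integrable f) (j k : Fin n) :
    Tendsto (fun R : ℝ => ∫ x, pd j (dilation R k) x * f x) atTop
      (𝓝 (if j = k then ∫ x, f x else 0)) := by
  obtain ⟨C, -, hC⟩ := exists_bound_pd (contDiff_bump_mul_coord k)
    (hasCompactSupport_bump_mul_coord k)
  have h0 : (if j = k then ∫ x, f x else 0) = ∫ x, (if j = k then 1 else 0) * f x := by
    split_ifs <;> simp
  rw [h0]
  refine tendsto_integral_filter_of_dominated_convergence (fun x => C * ‖f x‖)
    (Eventually.of_forall fun R =>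
      (continuous_pd (contDiff_dilation R k) j).aestronglyMeasurable.mul hf.aestronglyMeasurable)
    ?_ (hf.norm.const_mul C) ?_
  · filter_upwards [eventually_gt_atTop (0 : ℝ)] with R hR
    refine Eventually.of_forall fun x => ?_
    rw [norm_mul, pd_dilation hR]
    gcongr
    exact hC j _
  · refine Eventually.of_forall fun x => Tendsto.mul_const (f x) ?_
    rw [← pd_bump_mul_coord_zero]
    have h1 : Tendsto (fun R : ℝ => R⁻¹ • x) atTop (𝓝 0) := by
      simpa using (tendsto_inv_atTop_zero (𝕜 := ℝ)).smul_const x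
    refine (((continuous_pd (contDiff_bump_mul_coord k) j).tendsto 0).comp h1).congr' ?_
    filter_upwards [eventually_gt_atTop (0 : ℝ)] with R hR
    rw [pd_dilation hR]; rfl

end Virial

/-! ### Integrability, the Pohozaev identity and the planar massless case. -/

section Identities

variable {n N : ℕ} {A : DiracMatrices n N} {p : Params} {ω : ℝ} {φ : Space n → Fin N → ℂ}
  {h : Space n → ℝ}

/-- Boundedness of h makes m - g h a bounded coefficient, and β is an isometry, so the Dirac
equation bounds D₀φ by φ. -/
theorem IsStationary.integrable_diracOp (H : IsStationary A p ω φ h) :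
    Integrable fun x => sesq 1 (diracOp A φ x) (diracOp A φ x) := by
  obtain ⟨C, hC⟩ := H.bounded_scalar
  have hc := continuous_diracOp A H.contDiff_spinor
  refine (H.integrable_spinor.const_mul (2 * ω ^ 2 + 2 * (|p.m| + p.g * C) ^ 2)).mono'
    (continuous_sesq hc hc).aestronglyMeasurable (Eventually.of_forall fun x => ?_)
  rw [Real.norm_of_nonneg (sesq_one_self_nonneg _), H.dirac, sub_eq_add_neg, ← neg_smul]
  refine (sesq_one_add_le _ _).trans ?_
  have hβ : sesq 1 (A.β *ᵥ φ x) (A.β *ᵥ φ x) = sesq 1 (φ x) (φ x) := by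
    rw [sesq_mulVec_right, sesq_mulVec_left, A.β_selfAdjoint.eq, one_mul, A.β_sq]
  simp only [map_smul, smul_apply, smul_eq_mul, hβ]
  have hw : |p.m - p.g * h x| ≤ |p.m| + p.g * C := by
    refine (abs_sub _ _).trans ?_
    rw [abs_mul, abs_of_pos p.g_pos]
    gcongr
    · exact p.g_pos.le
    · exact hC x
  have hw2 : (p.m - p.g * h x) ^ 2 ≤ (|p.m| + p.g * C) ^ 2 :=
    sq_le_sq' (abs_le.1 hw).1 (abs_le.1 hw).2
  nlinarith [mul_le_mul_of_nonneg_right hw2 (sesq_one_self_nonneg (φ x))]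

theorem IsStationary.integrable_pd_spinor (H : IsStationary A p ω φ h) (j : Fin n) :
    Integrable fun x => sesq 1 (pd j φ x) (pd j φ x) := by
  have hc := continuous_pd H.contDiff_spinor j
  refine (integrable_pd_of_diracOp A H.contDiff_spinor H.integrable_spinor
    H.integrable_diracOp).1.mono' (continuous_sesq hc hc).aestronglyMeasurable
    (Eventually.of_forall fun x => ?_)
  rw [Real.norm_of_nonneg (sesq_one_self_nonneg _)]
  exact Finset.single_le_sum (f := fun j => sesq 1 (pd j φ x) (pd j φ x))
    (fun _ _ => sesq_one_self_nonneg _) (Finset.mem_univ j)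

theorem IsStationary.integrable_pd_sq (H : IsStationary A p ω φ h) (j : Fin n) :
    Integrable fun x => pd j h x ^ 2 := by
  have hc := (contDiff_pd H.contDiff_scalar j).continuous
  refine H.integrable_gradient.mono' (hc.pow 2).aestronglyMeasurable
    (Eventually.of_forall fun x => ?_)
  rw [Real.norm_of_nonneg (sq_nonneg _)]
  exact Finset.single_le_sum (f := fun j => pd j h x ^ 2) (fun _ _ => sq_nonneg _)
    (Finset.mem_univ j)

theorem IsStationary.integrable_stress (H : IsStationary A p ω φ h) (j k : Fin n) :
    Integrable (stress A p φ h j k) := by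
  have hp := fun j => (contDiff_pd H.contDiff_scalar j).continuous
  have h2 : Integrable fun x => pd k h x * pd j h x := by
    refine ((H.integrable_pd_sq k).add (H.integrable_pd_sq j)).mono'
      ((hp k).mul (hp j)).aestronglyMeasurable (Eventually.of_forall fun x => ?_)
    rw [Real.norm_eq_abs, abs_le, Pi.add_apply]
    constructor <;> nlinarith [sq_nonneg (pd k h x - pd j h x), sq_nonneg (pd k h x + pd j h x),
      sq_nonneg (pd k h x), sq_nonneg (pd j h x)]
  refine ((integrable_sesq (A.γ j) H.contDiff_spinor.continuous
    (continuous_pd H.contDiff_spinor k) H.integrable_spinor (H.integrable_pd_spinor k)).fun_add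
    (h2.const_mul p.g)).sub' ?_
  split_ifs
  · exact (H.integrable_gradient.fun_add H.integrable_mass).const_mul _
  · exact integrable_zero _ _ _

theorem IsStationary.integral_stress_diag (H : IsStationary A p ω φ h) (k : Fin n) :
    ∫ x, stress A p φ h k k x = 0 := by
  have hlim : Tendsto (fun R : ℝ => ∑ j, ∫ x, pd j (dilation R k) x * stress A p φ h j k x) atTop
      (𝓝 (∑ j, if j = k then ∫ x, stress A p φ h j k x else 0)) :=
    tendsto_finsetSum _ fun j _ => tendsto_integral_pd_dilation_mul (H.integrable_stress j k) j k
  rw [Finset.sum_ite_eq' Finset.univ k, if_pos (Finset.mem_univ k)] at hlim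
  refine tendsto_nhds_unique hlim (tendsto_const_nhds.congr' ?_)
  filter_upwards [eventually_gt_atTop (0 : ℝ)] with R hR
  obtain ⟨C, -, hC⟩ := exists_bound_pd (contDiff_dilation R k) (hasCompactSupport_dilation hR k)
  rw [← integral_finsetSum _ fun j _ => (H.integrable_stress j k).bdd_mul (c := C)
    (continuous_pd (contDiff_dilation R k) j).aestronglyMeasurable
    (Eventually.of_forall fun x => hC j x)]
  exact (H.integral_pd_mul_stress (contDiff_dilation R k) (hasCompactSupport_dilation hR k) k).symm

/-- The Pohozaev identity. -/
theorem IsStationary.pohozaev (H : IsStationary A p ω φ h) :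
    ∫ x, sesq 1 (φ x) (diracOp A φ x)
      = (n - 2) * (p.g / 2 * ∫ x, ∑ j, pd j h x ^ 2)
        + n * (p.g / 2 * ∫ x, p.M ^ 2 * h x ^ 2) := by
  have h1 : ∫ x, ∑ k, stress A p φ h k k x = 0 := by
    rw [integral_finsetSum _ fun k _ => H.integrable_stress k k]
    exact Finset.sum_eq_zero fun k _ => H.integral_stress_diag k
  have h2 : ∀ x, ∑ k, stress A p φ h k k x = sesq 1 (φ x) (diracOp A φ x)
      - ((n - 2) * (p.g / 2) * ∑ j, pd j h x ^ 2 + n * (p.g / 2) * (p.M ^ 2 * h x ^ 2)) := by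
    intro x
    simp only [stress, if_true, Finset.sum_sub_distrib, Finset.sum_add_distrib, sum_sesq_γ_right,
      Finset.sum_const, Finset.card_univ, Fintype.card_fin, nsmul_eq_mul, ← pow_two,
      ← Finset.mul_sum]
    ring
  have i1 := integrable_sesq 1 H.contDiff_spinor.continuous (continuous_diracOp A H.contDiff_spinor)
    H.integrable_spinor H.integrable_diracOp
  have i2 := H.integrable_gradient.const_mul ((n - 2) * (p.g / 2))
  have i3 := H.integrable_mass.const_mul (n * (p.g / 2))
  simp only [h2] at h1
  rw [integral_sub i1 (i2.fun_add i3), integral_add i2 i3, integral_const_mul,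
    integral_const_mul] at h1
  linarith

/-- In two dimensions, gradients of cutoff functions converge weakly to zero in `L²`. -/
theorem tendsto_integral_pd_cutoff_mul (hn : n = 2) {v : Space n → ℝ}
    (hv2 : Integrable fun x => v x ^ 2) (j : Fin n) :
    Tendsto (fun R : ℝ => ∫ x, pd j (cutoff R) x * v x) atTop (𝓝 0) := by
  obtain ⟨C, hC0, hC⟩ := exists_bound_pd_cutoff n
  set V := (volume : Measure (Space n)).real (Metric.ball 0 1) with hV
  have hV0 : 0 ≤ V := measureReal_nonneg
  set tail : ℝ → ℝ := fun R => ∫ x in (Metric.ball (0 : Space n) R)ᶜ, v x ^ 2 with htail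
  have htail0 : Tendsto tail atTop (𝓝 0) := by
    have hcov : AECover (volume : Measure (Space n)) atTop
      (fun R : ℝ => Metric.ball (0 : Space n) R) := aecover_ball tendsto_id
    have := (hcov.integral_tendsto_of_countably_generated hv2).const_sub (∫ x, v x ^ 2)
    rw [sub_self] at this
    refine this.congr fun R => ?_
    rw [← integral_add_compl (Metric.isOpen_ball.measurableSet : MeasurableSet
      (Metric.ball (0 : Space n) R)) hv2]
    simp [htail]
  -- Weighted Young inequality on R ≤ |x| ≤ 2R. In dimension two the area (2R)²V of the ball cancels
  -- (C/R)², so the gradient part stays bounded in R while the other factor is an L² tail.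
  have hbd : ∀ ε : ℝ, 0 < ε → ∀ R : ℝ, 0 < R →
      |∫ x, pd j (cutoff R) x * v x| ≤ ε * (4 * C ^ 2 * V) + ε⁻¹ * tail R := by
    intro ε hε R hR
    set f1 : Space n → ℝ := (Metric.closedBall (0 : Space n) (2 * R)).indicator
      fun _ => ε * (C / R) ^ 2
    set f2 : Space n → ℝ := (Metric.ball (0 : Space n) R)ᶜ.indicator fun x => ε⁻¹ * v x ^ 2
    have hf1 : Integrable f1 := (integrableOn_const
      (isCompact_closedBall _ _).measure_lt_top.ne).integrable_indicator
      Metric.isClosed_closedBall.measurableSet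
    have hf2 : Integrable f2 := (hv2.const_mul ε⁻¹).indicator
      Metric.isOpen_ball.measurableSet.compl
    have hpt : ∀ x, |pd j (cutoff R) x * v x| ≤ f1 x + f2 x := by
      intro x
      have p1 : 0 ≤ f1 x := Set.indicator_nonneg (fun _ _ => by positivity) x
      have p2 : 0 ≤ f2 x := Set.indicator_nonneg (fun _ _ => by positivity) x
      by_cases hx1 : ‖x‖ < R
      · rw [pd_cutoff_of_norm_lt hR hx1, zero_mul, abs_zero]
        positivity
      by_cases hx2 : ‖x‖ ≤ 2 * R
      · have e1 : f1 x = ε * (C / R) ^ 2 := Set.indicator_of_mem (by simpa using hx2) _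
        have e2 : f2 x = ε⁻¹ * v x ^ 2 := Set.indicator_of_mem (by simpa using hx1) _
        rw [e1, e2, abs_mul]
        have h1 := hC R hR j x
        have h2 : (C / R) * |v x| ≤ ε * (C / R) ^ 2 + ε⁻¹ * v x ^ 2 := by
          have h3 : 0 ≤ ε⁻¹ * (ε * (C / R) - |v x|) ^ 2 := by positivity
          have h4 : ε⁻¹ * (ε * (C / R) - |v x|) ^ 2
              = ε * (C / R) ^ 2 - 2 * ((C / R) * |v x|) + ε⁻¹ * v x ^ 2 := by
            rw [sub_sq, sq_abs]
            field_simp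
          have h5 : 0 ≤ C / R * |v x| := by positivity
          linarith
        refine le_trans ?_ h2
        gcongr
      · have hz : x ∉ tsupport (cutoff (n := n) R) := by
          intro hmem
          have hsub : tsupport (cutoff (n := n) R) ⊆ Metric.closedBall 0 (2 * R) := by
            refine closure_minimal (fun y hy => ?_) Metric.isClosed_closedBall
            rw [mem_closedBall_zero_iff]
            by_contra hlt
            exact hy (cutoff_eq_zero hR (not_le.1 hlt).le)
          exact hx2 (mem_closedBall_zero_iff.1 (hsub hmem))
        rw [pd_zero_of_notMem_tsupport hz, zero_mul, abs_zero]
        positivity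
    have hvol : (volume : Measure (Space n)).real (Metric.closedBall 0 (2 * R))
        = (2 * R) ^ 2 * V := by
      rw [Measure.addHaar_real_closedBall _ _ (by positivity), finrank_euclideanSpace_fin,
        show (2 * R) ^ n = (2 * R) ^ 2 by rw [hn]]
    calc |∫ x, pd j (cutoff R) x * v x| = ‖∫ x, pd j (cutoff R) x * v x‖ := (Real.norm_eq_abs _).symm
      _ ≤ ∫ x, (f1 x + f2 x) := norm_integral_le_of_norm_le (hf1.fun_add hf2) (Eventually.of_forall hpt)
      _ = ε * (4 * C ^ 2 * V) + ε⁻¹ * tail R := by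
          rw [integral_add hf1 hf2, integral_indicator Metric.isClosed_closedBall.measurableSet,
            integral_indicator Metric.isOpen_ball.measurableSet.compl, setIntegral_const, hvol,
            integral_const_mul, smul_eq_mul]
          field_simp
          ring
  rw [Metric.tendsto_atTop']
  intro δ hδ
  -- The summand 1 keeps K positive when C or V might vanish and makes the first bound strict.
  set K := 4 * C ^ 2 * V + 1 with hK
  have hK0 : 0 < K := by positivity
  set ε := δ / (2 * K) with hε
  have hε0 : 0 < ε := by positivity
  have h1 : ∀ᶠ R in atTop, tail R < ε * (δ / 2) := htail0.eventually_lt_const (by positivity)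
  obtain ⟨R0, hR0⟩ := (h1.and (eventually_gt_atTop (0 : ℝ))).exists_forall_of_atTop
  refine ⟨R0, fun R hR => ?_⟩
  obtain ⟨ht, hRpos⟩ := hR0 R hR.le
  rw [Real.dist_eq, sub_zero]
  refine (hbd ε hε0 R hRpos).trans_lt ?_
  have a1 : ε * (4 * C ^ 2 * V) < δ / 2 := by
    have : ε * K = δ / 2 := by rw [hε]; field_simp
    rw [← this]
    exact mul_lt_mul_of_pos_left (by rw [hK]; linarith) hε0
  have a2 : ε⁻¹ * tail R < δ / 2 := by
    rw [inv_mul_lt_iff₀ hε0]; exact ht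
  linarith

theorem IsStationary.integrable_barProd (H : IsStationary A p ω φ h) :
    Integrable fun x => (p.m - p.g * h x) * sesq A.β (φ x) (φ x) := by
  have i1 := integrable_sesq 1 H.contDiff_spinor.continuous (continuous_diracOp A H.contDiff_spinor)
    H.integrable_spinor H.integrable_diracOp
  refine ((H.integrable_spinor.const_mul ω).sub' i1).congr (Eventually.of_forall fun x => ?_)
  simp only [H.sesq_diracOp]
  ring

theorem IsStationary.kinetic_eq (H : IsStationary A p ω φ h) :
    ∫ x, sesq 1 (φ x) (diracOp A φ x)
      = ω * (∫ x, sesq 1 (φ x) (φ x)) - ∫ x, (p.m - p.g * h x) * sesq A.β (φ x) (φ x) := by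
  simp only [H.sesq_diracOp]
  rw [integral_sub (H.integrable_spinor.const_mul ω) H.integrable_barProd, integral_const_mul]

/-- The energy identity of the massless scalar field in two dimensions. -/
theorem IsStationary.integral_barProd_of_dim_two (H : IsStationary A p ω φ h) (hn : n = 2)
    (hM : p.M = 0) :
    ∫ x, (p.m - p.g * h x) * sesq A.β (φ x) (φ x) = -(p.g * ∫ x, ∑ j, pd j h x ^ 2) := by
  set w : Space n → ℝ := fun x => p.m - p.g * h x with hw
  have hh : ContDiff ℝ 1 h := H.contDiff_scalar.of_le (by norm_num)
  have hp : ∀ j, ContDiff ℝ 1 (pd j h) := contDiff_pd H.contDiff_scalar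
  have hw1 : ContDiff ℝ 1 w := contDiff_const.sub (contDiff_const.mul hh)
  obtain ⟨C, hC⟩ := H.bounded_scalar
  have hwb : ∀ x, w x ^ 2 ≤ (|p.m| + p.g * C) ^ 2 := by
    intro x
    have : |w x| ≤ |p.m| + p.g * C := by
      refine (abs_sub _ _).trans ?_
      rw [abs_mul, abs_of_pos p.g_pos]
      gcongr
      · exact p.g_pos.le
      · exact hC x
    exact sq_le_sq' (abs_le.1 this).1 (abs_le.1 this).2
  -- Since w is bounded, w ∂ⱼh lies in L², so the boundary terms created by the cutoff vanish in the
  -- limit.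
  have hv : ∀ j, Tendsto (fun R : ℝ => ∫ x, pd j (cutoff R) x * (w x * pd j h x)) atTop (𝓝 0) := by
    intro j
    refine tendsto_integral_pd_cutoff_mul hn ?_ j
    refine ((H.integrable_pd_sq j).const_mul ((|p.m| + p.g * C) ^ 2)).mono'
      ((hw1.continuous.mul (hp j).continuous).pow 2).aestronglyMeasurable
      (Eventually.of_forall fun x => ?_)
    rw [Real.norm_of_nonneg (sq_nonneg _), mul_pow]
    exact mul_le_mul_of_nonneg_right (hwb x) (sq_nonneg _)
  have hL := tendsto_integral_cutoff_mul H.integrable_barProd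
  have hG := (tendsto_integral_cutoff_mul H.integrable_gradient).const_mul (-p.g)
  have hS : Tendsto (fun R : ℝ => ∑ j, ∫ x, pd j (cutoff R) x * (w x * pd j h x)) atTop (𝓝 0) := by
    simpa using tendsto_finsetSum Finset.univ fun j _ => hv j
  have hR := hG.add hS
  rw [add_zero] at hR
  rw [← neg_mul]
  refine tendsto_nhds_unique hL (hR.congr' ?_)
  filter_upwards [eventually_gt_atTop (0 : ℝ)] with R hRpos
  have hχ : ContDiff ℝ 1 (cutoff (n := n) R) := contDiff_cutoff R (m := 1)
  have hcχ : HasCompactSupport (cutoff (n := n) R) := hasCompactSupport_cutoff hRpos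
  -- Multiply -Δh = φ̄φ by χw, with χ the cutoff, and use ∇w = -g∇h; the last sum is a divergence.
  have hpt : ∀ x, cutoff R x * (w x * sesq A.β (φ x) (φ x))
      = -p.g * (cutoff R x * ∑ j, pd j h x ^ 2) + ∑ j, pd j (cutoff R) x * (w x * pd j h x)
        - ∑ j, pd j (fun y => cutoff R y * (w y * pd j h y)) x := by
    intro x
    have dχ := hχ.differentiable one_ne_zero x
    have dw := hw1.differentiable one_ne_zero x
    have dp := fun j => (hp j).differentiable one_ne_zero x
    have hpw : ∀ j, pd j w x = -(p.g * pd j h x) := by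
      intro j
      simp only [pd, hw]
      rw [fderiv_const_sub, fderiv_const_mul (hh.differentiable one_ne_zero x)]
      simp
    have e1 : ∑ j, pd j (fun y => cutoff R y * (w y * pd j h y)) x
        = ∑ j, pd j (cutoff R) x * (w x * pd j h x) - p.g * cutoff R x * ∑ j, pd j h x ^ 2
          + cutoff R x * w x * ∑ j, pd j (pd j h) x := by
      simp only [Finset.mul_sum, ← Finset.sum_add_distrib, ← Finset.sum_sub_distrib]
      refine Finset.sum_congr rfl fun j _ => ?_
      rw [pd_mul dχ (dw.fun_mul (dp j)), pd_mul dw (dp j), hpw]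
      ring
    have hkg := H.kleinGordon x
    rw [hM] at hkg
    rw [e1, ← hkg]
    ring
  have i1 : Integrable fun x => -p.g * (cutoff R x * ∑ j, pd j h x ^ 2) :=
    ((hχ.continuous.mul (continuous_finsetSum _ fun j _ =>
      (hp j).continuous.pow 2)).integrable_of_hasCompactSupport hcχ.mul_right).const_mul _
  have i2 : ∀ j, Integrable fun x => pd j (cutoff R) x * (w x * pd j h x) := fun j =>
    ((continuous_pd hχ j).mul (hw1.continuous.mul
      (hp j).continuous)).integrable_of_hasCompactSupport (hasCompactSupport_pd hcχ j).mul_right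
  have c3 : ∀ j, ContDiff ℝ 1 fun y => cutoff R y * (w y * pd j h y) := fun j =>
    hχ.mul (hw1.mul (hp j))
  have i3 : ∀ j, Integrable (pd j fun y => cutoff R y * (w y * pd j h y)) := fun j =>
    (continuous_pd (c3 j) j).integrable_of_hasCompactSupport
      (hasCompactSupport_pd hcχ.mul_right j)
  have z3 : ∀ j, ∫ x, pd j (fun y => cutoff R y * (w y * pd j h y)) x = 0 := fun j =>
    integral_pd_eq_zero_of_hasCompactSupport (c3 j) hcχ.mul_right j
  change _ = ∫ x, cutoff R x * (w x * sesq A.β (φ x) (φ x))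
  simp only [hpt]
  rw [integral_sub (i1.fun_add (integrable_finsetSum _ fun j _ => i2 j))
      (integrable_finsetSum _ fun j _ => i3 j),
    integral_add i1 (integrable_finsetSum _ fun j _ => i2 j), integral_const_mul,
    integral_finsetSum _ fun j _ => i2 j, integral_finsetSum _ fun j _ => i3 j]
  simp [z3]

end Identities

/-! ### Exclusion of trivial scalar fields, positivity, and reduction to the stationary system. -/

section Positivity

variable {n N : ℕ} {A : DiracMatrices n N} {p : Params} {ω : ℝ} {φ : Space n → Fin N → ℂ}
  {h : Space n → ℝ}

theorem eq_const_of_pd_eq_zero {E : Type*} [NormedAddCommGroup E] [NormedSpace ℝ E]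
    {f : Space n → E} (hf : Differentiable ℝ f) (h0 : ∀ j x, pd j f x = 0) (x y : Space n) :
    f x = f y := by
  refine is_const_of_fderiv_eq_zero hf (fun x => ?_) x y
  refine ContinuousLinearMap.coe_injective
    ((EuclideanSpace.basisFun (Fin n) ℝ).toBasis.ext fun j => ?_)
  simpa [pd] using h0 j x

theorem eq_zero_of_integral_eq_zero {f : Space n → ℝ} (hf : Continuous f) (h0 : ∀ x, 0 ≤ f x)
    (hi : Integrable f) (hz : ∫ x, f x = 0) (x : Space n) : f x = 0 :=
  congrFun ((Continuous.ae_eq_iff_eq volume hf continuous_const).1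
    ((integral_eq_zero_iff_of_nonneg h0 hi).1 hz)) x

theorem IsStationary.charge_pos (H : IsStationary A p ω φ h) (hφ : φ ≠ 0) :
    0 < ∫ x, sesq 1 (φ x) (φ x) := by
  have h0 : ∀ x, 0 ≤ sesq 1 (φ x) (φ x) := fun x => sesq_one_self_nonneg _
  refine (integral_nonneg h0).lt_of_ne fun hz => hφ ?_
  ext1 x
  exact sesq_one_self_eq_zero.1 (eq_zero_of_integral_eq_zero
    (continuous_sesq H.contDiff_spinor.continuous H.contDiff_spinor.continuous) h0
    H.integrable_spinor hz.symm x)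

theorem IsStationary.pd_eq_zero (H : IsStationary A p ω φ h)
    (hT : ∫ x, ∑ j, pd j h x ^ 2 = 0) (j : Fin n) (x : Space n) : pd j h x = 0 := by
  have hx := eq_zero_of_integral_eq_zero (f := fun x => ∑ j, pd j h x ^ 2)
    (continuous_finsetSum _ fun j _ => (contDiff_pd H.contDiff_scalar j).continuous.pow 2)
    (fun x => Finset.sum_nonneg fun j _ => sq_nonneg _) H.integrable_gradient hT x
  rw [Finset.sum_eq_zero_iff_of_nonneg fun _ _ => sq_nonneg _] at hx
  exact pow_eq_zero_iff two_ne_zero |>.1 (hx j (Finset.mem_univ j))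

theorem IsStationary.mass_mul_eq_zero (H : IsStationary A p ω φ h)
    (hG : ∫ x, p.M ^ 2 * h x ^ 2 = 0) (x : Space n) : p.M * h x = 0 := by
  have hx := eq_zero_of_integral_eq_zero (f := fun x => p.M ^ 2 * h x ^ 2)
    (continuous_const.mul (H.contDiff_scalar.continuous.pow 2))
    (fun x => by positivity) H.integrable_mass hG x
  rw [← mul_pow] at hx
  exact pow_eq_zero_iff two_ne_zero |>.1 hx

/-- A square integrable spinor annihilated by the massless Dirac operator vanishes. -/
theorem eq_zero_of_diracOp_eq_zero (A : DiracMatrices n N) (hn : n ≠ 0)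
    (hφ : ContDiff ℝ 1 φ) (h0 : Integrable fun x => sesq 1 (φ x) (φ x))
    (hD : ∀ x, diracOp A φ x = 0) : φ = 0 := by
  have hnn : ∀ x, 0 ≤ ∑ j, sesq 1 (pd j φ x) (pd j φ x) := fun x =>
    Finset.sum_nonneg fun j _ => sesq_one_self_nonneg _
  obtain ⟨hi, hle⟩ := integrable_pd_of_diracOp A hφ h0 (by simp [hD])
  simp only [hD, map_zero, integral_zero, mul_zero] at hle
  have hpd : ∀ j x, pd j φ x = 0 := by
    intro j x
    have hx := eq_zero_of_integral_eq_zero (continuous_finsetSum _ fun j _ =>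
      continuous_sesq (continuous_pd hφ j) (continuous_pd hφ j)) hnn hi
      (le_antisymm hle (integral_nonneg hnn)) x
    rw [Finset.sum_eq_zero_iff_of_nonneg fun _ _ => sesq_one_self_nonneg _] at hx
    exact sesq_one_self_eq_zero.1 (hx j (Finset.mem_univ j))
  have hc := eq_const_of_pd_eq_zero (hφ.differentiable one_ne_zero) hpd
  have hfun : (fun x => sesq 1 (φ x) (φ x)) = fun _ => sesq 1 (φ 0) (φ 0) :=
    funext fun x => by rw [hc x 0]
  -- A constant is integrable on ℝⁿ with n ≠ 0 only if it is zero, the volume being infinite.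
  rw [hfun, integrable_const_iff] at h0
  have : Nonempty (Fin n) := ⟨⟨0, Nat.pos_of_ne_zero hn⟩⟩
  rcases h0 with h0 | h0
  · ext1 x
    rw [hc x 0, sesq_one_self_eq_zero.1 h0]; rfl
  · exact absurd h0.measure_univ_lt_top (by simp)

/-- There is no stationary solution with vanishing energy of the scalar field. -/
theorem IsStationary.not_trivial_scalar (H : IsStationary A p ω φ h) (hn : n ≠ 0) (hφ : φ ≠ 0)
    (hT : ∫ x, ∑ j, pd j h x ^ 2 = 0) (hG : ∫ x, p.M ^ 2 * h x ^ 2 = 0) : False := by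
  have hpd := H.pd_eq_zero hT
  have hmass := H.mass_mul_eq_zero hG
  have hQ := H.charge_pos hφ
  have hconst := eq_const_of_pd_eq_zero (H.contDiff_scalar.differentiable two_ne_zero) hpd
  have hβ : ∀ x, sesq A.β (φ x) (φ x) = 0 := by
    intro x
    have hz : ∀ j, pd j h = fun _ => 0 := fun j => funext (hpd j)
    rw [← H.kleinGordon, pow_two, mul_assoc, hmass x]
    simp [hz, pd]
  -- Pohozaev gives K = 0, while φ̄φ = 0 makes the Dirac equation give K = ωQ.
  have hω : ω = 0 := by
    have h1 := H.kinetic_eq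
    rw [H.pohozaev, hT, hG] at h1
    simp only [hβ, mul_zero, integral_zero, sub_zero, add_zero] at h1
    exact (mul_eq_zero.1 h1.symm).resolve_right hQ.ne'
  set m' := p.m - p.g * h 0 with hm'
  have hD : ∀ x, diracOp A φ x = -m' • (A.β *ᵥ φ x) := by
    intro x
    rw [H.dirac, hω, hconst x 0, zero_smul, zero_sub, neg_smul]
  have hd := H.contDiff_spinor.differentiable one_ne_zero
  have hherm : ∀ j, (A.β * A.γ j)ᴴ = A.β * A.γ j := by
    intro j
    rw [Matrix.conjTranspose_mul, γ_conjTranspose, A.β_selfAdjoint.eq, neg_mul, γ_β_anticomm,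
      neg_neg]
  -- The current φ*βγʲφ is real because βγʲ is Hermitian. Its divergence is 2 Re φ*βD₀φ = -2m'|φ|²,
  -- and integrating it gives m'Q = 0.
  have hpd2 : ∀ j, pd j (fun y => sesq (A.β * A.γ j) (φ y) (φ y))
      = fun x => 2 * sesq (A.β * A.γ j) (φ x) (pd j φ x) := by
    intro j
    ext x
    rw [pd_bilin _ (hd x) (hd x), sesq_swap _ (pd j φ x), hherm, two_mul]
  have hi : ∀ j, Integrable fun x => 2 * sesq (A.β * A.γ j) (φ x) (pd j φ x) := fun j =>
    (integrable_sesq _ H.contDiff_spinor.continuous (continuous_pd H.contDiff_spinor j)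
      H.integrable_spinor (H.integrable_pd_spinor j)).const_mul 2
  have hz : ∀ j, ∫ x, 2 * sesq (A.β * A.γ j) (φ x) (pd j φ x) = 0 := by
    intro j
    rw [← hpd2]
    refine integral_pd_eq_zero
      ((contDiff_sesq H.contDiff_spinor H.contDiff_spinor).differentiable one_ne_zero)
      (integrable_sesq _ H.contDiff_spinor.continuous H.contDiff_spinor.continuous
        H.integrable_spinor H.integrable_spinor) j ?_
    rw [hpd2]
    exact hi j
  have hsum : ∀ x, ∑ j, 2 * sesq (A.β * A.γ j) (φ x) (pd j φ x)
      = -2 * m' * sesq 1 (φ x) (φ x) := by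
    intro x
    have : sesq A.β (φ x) (diracOp A φ x) = ∑ j, sesq (A.β * A.γ j) (φ x) (pd j φ x) := by
      simp [diracOp_eq, map_sum, sesq_mulVec_right]
    rw [← Finset.mul_sum, ← this, hD, map_smul, sesq_mulVec_right, A.β_sq, smul_eq_mul]
    ring
  have hmQ : -2 * m' * ∫ x, sesq 1 (φ x) (φ x) = 0 := by
    rw [← integral_const_mul]
    simp only [← hsum]
    rw [integral_finsetSum _ fun j _ => hi j]
    exact Finset.sum_eq_zero fun j _ => hz j
  have hm0 : m' = 0 := by
    have := (mul_eq_zero.1 hmQ).resolve_right hQ.ne'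
    linarith
  exact hφ (eq_zero_of_diracOp_eq_zero A hn H.contDiff_spinor H.integrable_spinor
    fun x => by rw [hD, hm0, neg_zero, zero_smul])

theorem integral_sum_pd_sq_nonneg (h : Space n → ℝ) :
    0 ≤ ∫ x, ∑ j, pd j h x ^ 2 :=
  integral_nonneg fun _ => Finset.sum_nonneg fun _ _ => sq_nonneg _

theorem integral_mass_sq_nonneg (p : Params) (h : Space n → ℝ) :
    0 ≤ ∫ x, p.M ^ 2 * h x ^ 2 :=
  integral_nonneg fun _ => by positivity

theorem IsStationary.kinetic_pos (H : IsStationary A p ω φ h) (hn : 2 ≤ n) (hω : 0 ≤ ω)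
    (hφ : φ ≠ 0) : 0 < ∫ x, sesq 1 (φ x) (diracOp A φ x) := by
  have hT := integral_sum_pd_sq_nonneg h
  have hG := integral_mass_sq_nonneg p h
  have hQ := H.charge_pos hφ
  have hg := p.g_pos
  have hn0 : n ≠ 0 := by omega
  set T := ∫ x, ∑ j, pd j h x ^ 2 with hTdef
  set G := ∫ x, p.M ^ 2 * h x ^ 2 with hGdef
  have hK : ∫ x, sesq 1 (φ x) (diracOp A φ x)
      = (n - 2) * (p.g / 2 * T) + n * (p.g / 2 * G) := H.pohozaev
  have hn' : (2 : ℝ) ≤ n := by exact_mod_cast hn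
  have hT' : 0 ≤ ((n : ℝ) - 2) * (p.g / 2 * T) := mul_nonneg (by linarith) (by positivity)
  rcases hG.lt_or_eq with hGpos | hG0
  · rw [hK]
    have : 0 < (n : ℝ) * (p.g / 2 * G) := by positivity
    linarith
  have hTpos : 0 < T := hT.lt_of_ne fun hT0 => H.not_trivial_scalar hn0 hφ hT0.symm hG0.symm
  rcases hn.lt_or_eq with hn3 | hn2
  · have : (2 : ℝ) < n := by exact_mod_cast hn3
    rw [hK, ← hG0]
    have : 0 < ((n : ℝ) - 2) * (p.g / 2 * T) := mul_pos (by linarith) (by positivity)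
    linarith
  -- Here n = 2 and G = 0, so Pohozaev gives no positivity. If M ≠ 0, then h = 0, contradicting T >
  -- 0.
  by_cases hM : p.M = 0
  · rw [H.kinetic_eq, H.integral_barProd_of_dim_two hn2.symm hM, sub_neg_eq_add]
    have : 0 < p.g * T := by positivity
    have : 0 ≤ ω * ∫ x, sesq 1 (φ x) (φ x) := by positivity
    linarith
  · have hz : h = fun _ => 0 := funext fun x =>
      (mul_eq_zero.1 (H.mass_mul_eq_zero hG0.symm x)).resolve_left hM
    refine absurd hTpos ?_
    simp [hTdef, hz, pd]

theorem IsStationary.energy_pos (H : IsStationary A p ω φ h) (hn : 2 ≤ n) (hω : 0 ≤ ω)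
    (hφ : φ ≠ 0) :
    0 < ω * (∫ x, sesq 1 (φ x) (φ x)) + p.g / 2 * (∫ x, ∑ j, pd j h x ^ 2)
      + p.g / 2 * ∫ x, p.M ^ 2 * h x ^ 2 := by
  have hT := integral_sum_pd_sq_nonneg h
  have hG := integral_mass_sq_nonneg p h
  have hQ := H.charge_pos hφ
  have hg := p.g_pos
  have hωQ := mul_nonneg hω hQ.le
  have hgT := mul_nonneg (half_pos hg).le hT
  have hgG := mul_nonneg (half_pos hg).le hG
  rcases hT.lt_or_eq with hT1 | hT0
  · have := mul_pos (half_pos hg) hT1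
    linarith
  rcases hG.lt_or_eq with hG1 | hG0
  · have := mul_pos (half_pos hg) hG1
    linarith
  exact (H.not_trivial_scalar (by omega) hφ hT0.symm hG0.symm).elim

theorem barProd_eq (A : DiracMatrices n N) (v : Fin N → ℂ) :
    barProd A v = ((sesq A.β v v : ℝ) : ℂ) := by
  have h1 : star (barProd A v) = barProd A v := by
    rw [barProd, star_dotProduct_mulVec, A.β_selfAdjoint.eq]
  exact (Complex.conj_eq_iff_re.1 h1).symm

theorem IsSolitaryWave.isStationary (H : IsSolitaryWave A p ω φ h) :
    IsStationary A p ω φ h := by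
  have hsol := H.isSolution
  have hφ : ContDiff ℝ 1 φ := by
    have := hsol.contDiff_spinor.comp (contDiff_prodMk_right (𝕜 := ℝ) (n := 1) (F := Space n) (0 : ℝ))
    simpa [Function.comp_def] using this
  have hh : ContDiff ℝ 2 h :=
    hsol.contDiff_scalar.comp (contDiff_prodMk_right (𝕜 := ℝ) (n := 2) (F := Space n) (0 : ℝ))
  refine ⟨hφ, hh, fun x => ?_, fun x => ?_, ?_, H.bounded_scalar, ?_, ?_⟩
  -- At t = 0 the phase is 1 and its derivative is -iω, so i∂ₜ acts as multiplication by ω.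
  · have hd := hsol.dirac 0 x
    have hder : deriv (fun s : ℝ => Complex.exp (-Complex.I * (ω : ℂ) * (s : ℂ)) • φ x) 0
        = (-Complex.I * ω) • φ x := by
      have h1 : HasDerivAt (fun s : ℝ => Complex.exp (-Complex.I * (ω : ℂ) * (s : ℂ)))
          (-Complex.I * ω) 0 := by
        have h2 : HasDerivAt (fun s : ℝ => -Complex.I * (ω : ℂ) * (s : ℂ)) (-Complex.I * ω) 0 := by
          simpa using (Complex.ofRealCLM.hasDerivAt (x := (0 : ℝ))).const_mul (-Complex.I * (ω : ℂ))
        simpa using h2.cexp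
      exact (h1.smul_const (φ x)).deriv
    rw [hder] at hd
    simp only [Complex.ofReal_zero, mul_zero, Complex.exp_zero, one_smul] at hd
    have hω : Complex.I • (-Complex.I * (ω : ℂ)) • φ x = ω • φ x := by
      rw [smul_smul, ← mul_assoc, mul_neg, Complex.I_mul_I, neg_neg, one_mul, Complex.coe_smul]
    rw [hω, Complex.coe_smul] at hd
    exact eq_sub_of_add_eq hd.symm
  · have hk := hsol.kleinGordon 0 x
    simp only [Complex.ofReal_zero, mul_zero, Complex.exp_zero, one_smul, barProd_eq] at hk
    have hk' := Complex.ofReal_injective hk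
    rw [laplacian_eq_sum_pd hh, iteratedDeriv_const] at hk'
    simpa using hk'
  · have h2 := (memLp_two_iff_integrable_sq_norm hφ.continuous.aestronglyMeasurable).1
      H.memLp_spinor
    refine (h2.const_mul (N : ℝ)).mono'
      (continuous_sesq hφ.continuous hφ.continuous).aestronglyMeasurable
      (Eventually.of_forall fun x => ?_)
    rw [Real.norm_of_nonneg (sesq_one_self_nonneg _), sesq_one_self]
    calc ∑ a, ‖φ x a‖ ^ 2 ≤ ∑ _a : Fin N, ‖φ x‖ ^ 2 :=
          Finset.sum_le_sum fun a _ => by gcongr; exact norm_le_pi_norm _ a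
      _ = _ := by simp
  · have := (memLp_two_iff_integrable_sq_norm H.memLp_gradient.aestronglyMeasurable).1
      H.memLp_gradient
    simpa only [norm_gradient_sq] using this
  · have := (memLp_two_iff_integrable_sq H.memLp_mass.aestronglyMeasurable).1 H.memLp_mass
    simpa only [mul_pow] using this

theorem IsStationary.kineticDensity_eq (H : IsStationary A p ω φ h) (x : Space n) :
    kineticDensity A φ x = ((sesq 1 (φ x) (diracOp A φ x) : ℝ) : ℂ) := by
  have h1 : star (φ x) ⬝ᵥ φ x = ((sesq 1 (φ x) (φ x) : ℝ) : ℂ) := by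
    rw [sesq_apply, Matrix.one_mulVec]
    refine (Complex.conj_eq_iff_re.1 ?_).symm
    have := star_dotProduct_mulVec (1 : Matrix (Fin N) (Fin N) ℂ) (φ x) (φ x)
    simpa using this
  have h2 := barProd_eq A (φ x)
  rw [barProd] at h2
  rw [H.sesq_diracOp, kineticDensity, H.dirac, dotProduct_sub, dotProduct_smul, dotProduct_smul,
    h1, h2]
  simp

/-- On a solution, the Dirac equation collapses the three fermionic terms, including the
interaction, to ω|φ|², leaving a sum of nonnegative terms when ω ≥ 0. -/
theorem IsStationary.energyDensity_eq (H : IsStationary A p ω φ h) (x : Space n) :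
    energyDensity A p φ h x = ((ω * sesq 1 (φ x) (φ x) + p.g / 2 * ∑ j, pd j h x ^ 2
      + p.g / 2 * (p.M ^ 2 * h x ^ 2) : ℝ) : ℂ) := by
  rw [energyDensity, H.kineticDensity_eq, H.sesq_diracOp, barProd_eq, norm_gradient_sq]
  push_cast
  ring

end Positivity
end DKG

/-- Positivity `0 < z` of a complex number means that `z` is real and positive. -/
theorem mainTheorem2 (n N : ℕ) (hn : 2 ≤ n) (A : DKG.DiracMatrices n N) (p : DKG.Params)
    (ω : ℝ) (hω : 0 ≤ ω) (φ : DKG.Space n → Fin N → ℂ) (h : DKG.Space n → ℝ)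
    (hsw : DKG.IsSolitaryWave A p ω φ h) :
    (Integrable (DKG.kineticDensity A φ) volume ∧ 0 < DKG.kinetic A φ) ∧
    (Integrable (DKG.energyDensity A p φ h) volume ∧ 0 < DKG.energy A p φ h) := by
  have H := hsw.isStationary
  have hK := DKG.integrable_sesq 1 H.contDiff_spinor.continuous
    (DKG.continuous_diracOp A H.contDiff_spinor) H.integrable_spinor H.integrable_diracOp
  have i1 := H.integrable_spinor.const_mul ω
  have i2 := H.integrable_gradient.const_mul (p.g / 2)
  have i3 := H.integrable_mass.const_mul (p.g / 2)
  have eK : DKG.kineticDensity A φ = _ := funext H.kineticDensity_eq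
  have eE : DKG.energyDensity A p φ h = _ := funext H.energyDensity_eq
  refine ⟨⟨?_, ?_⟩, ?_, ?_⟩
  · rw [eK]
    exact hK.ofReal
  · rw [DKG.kinetic, eK, integral_complex_ofReal, Complex.zero_lt_real]
    exact H.kinetic_pos hn hω hsw.ne_zero
  · rw [eE]
    exact ((i1.fun_add i2).fun_add i3).ofReal
  · rw [DKG.energy, eE, integral_complex_ofReal, Complex.zero_lt_real,
      integral_add (i1.fun_add i2) i3, integral_add i1 i2, integral_const_mul, integral_const_mul,
      integral_const_mul]
    exact H.energy_pos hn hω hsw.ne_zero
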